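/- **Setting.** Let $(\mathcal D,\preceq,D)$ be a generalized probability distance: $(\mathcal D,\preceq)$ is a poset and $D$ assigns to any two random variables $X,X'$ on a common measurable space (depending only on their laws) an element $D(X,X')\in\mathcal D$, such that $D(g(X),g(X'))\preceq D(X,X')$ for every measurable $g$, and such that, if $D(X_i,X_i')\preceq d$ for all $i\in\mathcal I$ and $I$ is a random index in $\mathcal I$, then $D(X_I,X'_I)\preceq d$. Let $\mathcal X$ be a set of datasets with a neighboring relation. Write $\mathcal D^*=\bigcup_{k\ge 0}\mathcal D^k$. An *interactive mechanism* (I.M.) is a randomized state machine that is initialized on a dataset $x\in\mathcal X$, sends a first message, and then answers queries one at a time; an *adversary* is a randomized state machine that, on each message received, tosses coins and sends a query or halts. A mechanism that has halted goes on sending dummy messages. $\mathrm{View}(\mathcal A\leftrightarrow\mathcal M(x))$ is the (finite or infinite) sequence of the messages received by $\mathcal A$ and of the coins it tosses. $\mathcal M$ is $d$-$\mathcal D$ DP if $D(\mathrm{View}(\mathcal A\leftrightarrow\mathcal M(x)),\mathrm{View}(\mathcal A\leftrightarrow\mathcal M(x')))\preceq d$ for all adversaries $\mathcal A$ and all neighboring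 $x,x'$. A noninteractive mechanism $\mathcal M$ is $d$-$\mathcal D$ DP if $D(\mathcal M(x),\mathcal M(x'))\preceq d$ for all neighboring $x,x'$. The composed mechanisms have binary strings as outputs (and as queries). *Filters.* For $\mathcal F:\mathcal D^*\times\mathcal D\to\{0,1\}$ and $d\in\mathcal D$, the I.M. $\mathcal F(\cdot;d)\text{-}Filt(NIM)$ keeps the dataset $x$ and the list $(d_1,\dots,d_k)$, initially empty, of the parameters used so far, and sends an empty first message. On a query $(\mathcal M',d')$ with $\mathcal M'$ a noninteractive mechanism: if $\mathcal M'$ is not $d'$-$\mathcal D$ DP it returns an error message and keeps its state; otherwise, if $\mathcal F(d_1,\dots,d_k,d';d)=1$, it appends $d'$ to the list and returns $\mathcal M'(x)$, and if not, it reports an insufficient budget and halts. Every other query is answered by "invalid query", with no change of state. $\mathcal F(\cdot;d)\text{-}FiltCon(IM)$ is defined in the same way for interactive $\mathcal M'$: an accepted query $(\mathcal M',d')$ initializes $\mathcal M'$ on $x$ and returns its first message, and in addition, at any time, a query $(j,q)$ sends $q$ to the $j$-th mechanism started so far and returns its answer. $\mathcal F$ is a *valid $\mathcal D$-DP NIM-filter*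 (resp. *concurrent IM-filter*) if for every $d\in\mathcal D$ the I.M. $\mathcal F(\cdot;d)\text{-}Filt(NIM)$ (resp. $\mathcal F(\cdot;d)\text{-}FiltCon(IM)$) is $d$-$\mathcal D$ DP. *Odometers.* For $\mathcal G:\mathcal D^*\to\mathcal D$, the I.M. $\mathcal G\text{-}Odom(NIM)$ (resp. $\mathcal G\text{-}OdomCon(IM)$) works like the corresponding filter, except that no budget is checked (every $d'$-$\mathcal D$ DP mechanism $\mathcal M'$ is accepted) and that a query $\texttt{privacy\_loss}$ is answered by $\mathcal G(d_1,\dots,d_k)$, with no change of state. For an odometer $\mathcal O$, $\mathrm{Trunc}_d(\mathrm{View}(\mathcal A\leftrightarrow\mathcal O(x)))$ is the view of $\mathcal A$ cut off at the first message of $\mathcal O$ (the initial one included) after which the privacy loss of $\mathcal O$ is not $\preceq d$; that message is left out. $\mathcal O$ is a *valid $\mathcal D$-DP odometer* if $D(\mathrm{Trunc}_d(\mathrm{View}(\mathcal A\leftrightarrow\mathcal O(x))),\mathrm{Trunc}_d(\mathrm{View}(\mathcal A\leftrightarrow\mathcal O(x'))))\preceq d$ for all $d\in\mathcal D$, all adversaries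 $\mathcal A$ and all neighboring $x,x'$. $\mathcal G$ is a *valid NIM-privacy-loss accumulator* (resp. *concurrent IM-privacy-loss accumulator*) if $\mathcal G\text{-}Odom(NIM)$ (resp. $\mathcal G\text{-}OdomCon(IM)$) is a valid $\mathcal D$-DP odometer. **Lemma.** Let $\mathcal G:\mathcal D^*\to\mathcal D$ satisfy $\mathcal G()\preceq\mathcal G(d_1)$ for all $d_1\in\mathcal D$, where $()$ is the empty sequence, and let $\mathcal F(\cdot;d)=\mathbb I(\mathcal G(\cdot)\preceq d)$. 1. $\mathcal G$ is a valid NIM-privacy-loss accumulator if and only if $\mathcal F$ is a valid $\mathcal D$-DP NIM-filter. 2. $\mathcal G$ is a valid concurrent IM-privacy-loss accumulator if and only if $\mathcal F$ is a valid $\mathcal D$-DP concurrent IM-filter. In both parts the implication from $\mathcal F$ to $\mathcal G$ holds without the assumption $\mathcal G()\preceq\mathcal G(d_1)$. -/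

import Mathlib

open MeasureTheory ProbabilityTheory

namespace ConcurrentDP

noncomputable section

/-! ### Generalized probability distances -/

/-- A generalized probability distance with values in the poset `𝒟`. A distance between random
variables depends only on their laws, so it is a function of two probability measures on the same
measurable space. -/
structure GeneralizedDistance (𝒟 : Type) [PartialOrder 𝒟] where
  /-- The distance between two laws on a common measurable space. -/
  dist : ∀ {Ω : Type} [MeasurableSpace Ω], ProbabilityMeasure Ω → ProbabilityMeasure Ω → 𝒟
  /-- Closure under postprocessing by measurable maps. -/
  postprocessing : ∀ {Ω Ω' : Type} [MeasurableSpace Ω] [MeasurableSpace Ω'] (g : Ω → Ω')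
    (hg : Measurable g) (μ ν : ProbabilityMeasure Ω),
    dist (μ.map hg.aemeasurable) (ν.map hg.aemeasurable) ≤ dist μ ν
  /-- Joint convexity: `κ i` and `κ' i` are the laws of `X i` and `X' i`, and `μ` is the law of the
  random index. -/
  joint_convexity : ∀ {I Ω : Type} [MeasurableSpace I] [MeasurableSpace Ω] (κ κ' : Kernel I Ω)
    [IsMarkovKernel κ] [IsMarkovKernel κ'] (μ : ProbabilityMeasure I) (d : 𝒟),
    (∀ i, dist ⟨κ i, inferInstance⟩ ⟨κ' i, inferInstance⟩ ≤ d) →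
    dist ⟨κ ∘ₘ (μ : Measure I), inferInstance⟩ ⟨κ' ∘ₘ (μ : Measure I), inferInstance⟩ ≤ d

/-! ### Interactive mechanisms, adversaries, views -/

/-- Finite binary strings, with the discrete σ-algebra. -/
abbrev Str : Type := List Bool

instance instMeasurableSpaceStr : MeasurableSpace Str := ⊤

universe u v

/-- An interactive mechanism (randomized state machine) on datasets `X` with queries `Q` and
answers `A`. `init x` is the response to the empty initial message `λ`; a later query is never
empty. A mechanism that has halted goes into a looping state with dummy answers. -/
structure Mechanism (X : Type) (Q : Type u) (A : Type) where
  /-- The states. -/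
  State : Type v
  /-- Initialization on a dataset, with the first message to the adversary. -/
  init : X → PMF (State × A)
  /-- New state and answer, given the current state and a query. -/
  step : State → Q → PMF (State × A)

/-- An adversary: on receiving a message it tosses coins and computes from its state, the message
and the coins a new state and either a query or `none`, the message `halt`. -/
structure Adversary (Q : Type u) (A : Type) where
  /-- The states. -/
  State : Type
  /-- The initial state. -/
  start : State
  /-- The law of the coins tossed when a message is received. -/
  coins : State → A → PMF Str
  /-- New state and message, given the current state, the message received and the coins. -/
  act : State → A → Str → State × Option Q

/-- One entry of a view: the coins of the adversary together with the answer then received, or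
with `none` if the view ends with these coins. The entry itself is `none` after the end. -/
def Entry (A : Type) : Type := Option (Str × Option A)

instance instMeasurableSpaceEntry (A : Type) : MeasurableSpace (Entry A) := ⊤

/-- Finite and infinite views `(r₀, m₁), (r₂, m₃), (r₄, m₅), …`, where `r₀` is the empty string,
with the product σ-algebra. -/
abbrev View (A : Type) : Type := ℕ → Entry A

/-- A stage of the interaction: the state of the mechanism, the state of the adversary and the
message just sent to the adversary (or `none` if the interaction is over), with the entry that
this round has contributed to the view. -/
def Stage (S : Type v) (T A : Type) : Type v := Option (S × T × A) × Entry A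

instance instMeasurableSpaceStage (S : Type v) (T A : Type) : MeasurableSpace (Stage S T A) := ⊤

section Interaction

variable {X : Type} {Q : Type u} {A : Type}

open Classical in
/-- The stage reached when the mechanism, now in state `s`, answers `a` to an adversary in state
`t` that has tossed the coins `r`. If `s` satisfies `cut`, then the answer is withheld and the
interaction is over. -/
def deliver {S : Type v} {T : Type} (cut : S → Prop) (t : T) (r : Str) (s : S) (a : A) :
    Stage S T A :=
  if cut s then (none, some (r, none)) else (some (s, t, a), some (r, some a))

/-- The law of the first stage. -/
def firstStage (𝒜 : Adversary Q A) (M : Mechanism.{u, v} X Q A) (cut : M.State → Prop) (x : X) :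
    PMF (Stage M.State 𝒜.State A) :=
  (M.init x).map fun p => deliver cut 𝒜.start [] p.1 p.2

/-- The law of the next stage: the adversary tosses coins and halts or asks a query, which the
mechanism answers. -/
def nextStage (𝒜 : Adversary Q A) (M : Mechanism.{u, v} X Q A) (cut : M.State → Prop) :
    Stage M.State 𝒜.State A → PMF (Stage M.State 𝒜.State A)
  | (none, _) => PMF.pure (none, none)
  | (some (s, t, a), _) => (𝒜.coins t a).bind fun r =>
      match 𝒜.act t a r with
      | (_, none) => PMF.pure (none, some (r, none))
      | (t', some q) => (M.step s q).map fun p => deliver cut t' r p.1 p.2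

/-- The law of a discrete-state Markov chain after step `n`, given its past. -/
def chainKernel {S : Type v} [MeasurableSpace S] [DiscreteMeasurableSpace S] (next : S → PMF S)
    (n : ℕ) : Kernel (∀ _ : Finset.Iic n, S) S where
  toFun h := (next (h ⟨n, Finset.mem_Iic.2 le_rfl⟩)).toMeasure
  measurable' := (Measurable.of_discrete (f := fun s => (next s).toMeasure)).comp
    (measurable_pi_apply _)

instance instIsMarkovKernelChainKernel {S : Type v} [MeasurableSpace S] [DiscreteMeasurableSpace S]
    (next : S → PMF S) (n : ℕ) : IsMarkovKernel (chainKernel next n) :=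
  ⟨fun h => inferInstanceAs
    (IsProbabilityMeasure (next (h ⟨n, Finset.mem_Iic.2 le_rfl⟩)).toMeasure)⟩

instance instDiscreteMeasurableSpaceStage (S : Type v) (T A : Type) :
    DiscreteMeasurableSpace (Stage S T A) :=
  ⟨fun _ => trivial⟩

/-- The law of the sequence of all stages of the interaction. -/
def stagesLaw (𝒜 : Adversary Q A) (M : Mechanism.{u, v} X Q A) (cut : M.State → Prop) (x : X) :
    Measure (ℕ → Stage M.State 𝒜.State A) :=
  Kernel.trajMeasure (X := fun _ => Stage M.State 𝒜.State A)
    (firstStage 𝒜 M cut x).toMeasure (chainKernel (nextStage 𝒜 M cut))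

instance instIsProbabilityMeasureStagesLaw (𝒜 : Adversary Q A) (M : Mechanism.{u, v} X Q A)
    (cut : M.State → Prop) (x : X) : IsProbabilityMeasure (stagesLaw 𝒜 M cut x) := by
  unfold stagesLaw
  infer_instance

theorem measurable_entries (S : Type v) (T A : Type) :
    Measurable (fun (ω : ℕ → Stage S T A) (n : ℕ) => ((ω n).2 : Entry A)) :=
  measurable_pi_lambda _ fun n =>
    (Measurable.of_discrete (f := fun s : Stage S T A => (s.2 : Entry A))).comp
      (measurable_pi_apply n)

/-- The law of the adversary's view up to the first answer that leads to a state in `cut`; this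
answer is withheld. -/
def stoppedView (𝒜 : Adversary Q A) (M : Mechanism.{u, v} X Q A) (cut : M.State → Prop) (x : X) :
    ProbabilityMeasure (View A) :=
  ProbabilityMeasure.map ⟨stagesLaw 𝒜 M cut x, inferInstance⟩
    (measurable_entries M.State 𝒜.State A).aemeasurable

/-- The law of `View(𝒜 ↔ M(x))`. -/
def view (𝒜 : Adversary Q A) (M : Mechanism.{u, v} X Q A) (x : X) : ProbabilityMeasure (View A) :=
  stoppedView 𝒜 M (fun _ => False) x

end Interaction

/-! ### `𝒟`-DP mechanisms and odometers -/

section Privacy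

variable {𝒟 : Type} [PartialOrder 𝒟] (D : GeneralizedDistance 𝒟)
variable {X : Type} (adj : X → X → Prop)

/-- `M` is a `d`-`𝒟` DP interactive mechanism. -/
def IsDP {Q : Type u} {A : Type} (d : 𝒟) (M : Mechanism.{u, v} X Q A) : Prop :=
  ∀ (𝒜 : Adversary Q A) (x x' : X), adj x x' → D.dist (view 𝒜 M x) (view 𝒜 M x') ≤ d

/-- The law of the output of a noninteractive mechanism on a dataset. -/
def outputLaw (M : X → PMF Str) (x : X) : ProbabilityMeasure Str :=
  ⟨(M x).toMeasure, inferInstance⟩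

/-- `M` is a `d`-`𝒟` DP noninteractive mechanism. -/
def IsNoninteractiveDP (d : 𝒟) (M : X → PMF Str) : Prop :=
  ∀ x x' : X, adj x x' → D.dist (outputLaw M x) (outputLaw M x') ≤ d

/-- An odometer: an interactive mechanism with a designated query that is answered
deterministically by the current privacy loss and does not change the state. -/
structure Odometer (𝒟 : Type) (X : Type) (Q : Type u) (A : Type) extends
    Mechanism.{u, v} X Q A where
  /-- The privacy-loss query. -/
  lossQuery : Q
  /-- The message that states a privacy loss. -/
  lossAnswer : 𝒟 → A
  lossAnswer_injective : Function.Injective lossAnswer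
  /-- The privacy loss reported in a state. -/
  loss : State → 𝒟
  step_lossQuery : ∀ s, step s lossQuery = PMF.pure (s, lossAnswer (loss s))

/-- The law of `Trunc_d(View(𝒜 ↔ O(x)))`: after each answer of the odometer, the initial one
included, its privacy loss is queried; as soon as it is not `≤ d`, the interaction is cut off and
the last answer is left out. -/
def truncatedView {Q : Type u} {A : Type} (d : 𝒟) (𝒜 : Adversary Q A)
    (O : Odometer.{u, v} 𝒟 X Q A) (x : X) : ProbabilityMeasure (View A) :=
  stoppedView 𝒜 O.toMechanism (fun s => ¬ O.loss s ≤ d) x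

/-- `O` is a valid `𝒟` DP odometer. -/
def IsValidOdometer {Q : Type u} {A : Type} (O : Odometer.{u, v} 𝒟 X Q A) : Prop :=
  ∀ (d : 𝒟) (𝒜 : Adversary Q A) (x x' : X), adj x x' →
    D.dist (truncatedView d 𝒜 O x) (truncatedView d 𝒜 O x') ≤ d

/-! ### Messages of filters and odometers -/

/-- Answers of filters and odometers. -/
inductive Answer (𝒟 : Type) : Type
  /-- The empty message sent on initialization. -/
  | empty
  /-- A message of one of the composed mechanisms. -/
  | message (m : Str)
  /-- The answer to a privacy-loss query. -/
  | loss (d : 𝒟)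
  /-- The mechanism to be launched does not have the declared privacy parameter. -/
  | notPrivate
  | insufficientBudget
  | invalidQuery
  /-- The dummy message that is repeated after halting. -/
  | halted

/-- Queries in the noninteractive setting. -/
inductive NIMQuery (𝒟 : Type) (X : Type) : Type
  /-- Run the noninteractive mechanism `M` with declared privacy parameter `d`. -/
  | launch (M : X → PMF Str) (d : 𝒟)
  | privacyLoss
  /-- Any message that cannot be parsed. -/
  | other (m : Str)

/-- The interactive mechanisms that are composed: they communicate through binary strings. -/
abbrev IM (X : Type) : Type 1 := Mechanism.{0, 0} X Str Str

/-- Queries in the concurrent interactive setting. -/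
inductive IMQuery (𝒟 : Type) (X : Type) : Type 1
  /-- Start the interactive mechanism `M` with declared privacy parameter `d`. -/
  | launch (M : IM X) (d : 𝒟)
  /-- Send `q` to the mechanism with index `j`, counted from zero in the order of launching. -/
  | ask (j : ℕ) (q : Str)
  | privacyLoss
  /-- Any message that cannot be parsed. -/
  | other (m : Str)

/-- A launched interactive mechanism with its privacy parameter and current state. -/
structure Launched (𝒟 : Type) (X : Type) : Type 1 where
  /-- The mechanism. -/
  mech : IM X
  /-- Its declared privacy parameter. -/
  param : 𝒟
  /-- Its current state. -/
  state : mech.State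

/-- The rule `F(·; d) = 𝕀(G(·) ≼ d)`. -/
def ruleOf (G : List 𝒟 → 𝒟) (l : List 𝒟) (d : 𝒟) : Bool :=
  open Classical in decide (G l ≤ d)

/-! ### Noninteractive setting -/

open Classical in
/-- `F(·; d)-Filt(NIM)`. A state is a dataset with the list of privacy parameters used so far, or
`none` for `Halt`. -/
def filtNIM (F : List 𝒟 → 𝒟 → Bool) (d : 𝒟) :
    Mechanism.{0, 0} X (NIMQuery 𝒟 X) (Answer 𝒟) where
  State := Option (X × List 𝒟)
  init x := PMF.pure (some (x, []), .empty)
  step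
    | none, _ => PMF.pure (none, .halted)
    | some (x, l), .launch M d' =>
        if IsNoninteractiveDP D adj d' M then
          if F (l ++ [d']) d = true then
            (M x).map fun m => (some (x, l ++ [d']), .message m)
          else PMF.pure (none, .insufficientBudget)
        else PMF.pure (some (x, l), .notPrivate)
    | some (x, l), .privacyLoss => PMF.pure (some (x, l), .invalidQuery)
    | some (x, l), .other _ => PMF.pure (some (x, l), .invalidQuery)

/-- `F` is a valid `𝒟` DP NIM-filter. -/
def IsValidNIMFilter (F : List 𝒟 → 𝒟 → Bool) : Prop :=
  ∀ d : 𝒟, IsDP D adj d (filtNIM D adj F d)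

open Classical in
/-- `G-Odom(NIM)`. -/
def odomNIM (G : List 𝒟 → 𝒟) : Odometer.{0, 0} 𝒟 X (NIMQuery 𝒟 X) (Answer 𝒟) where
  State := X × List 𝒟
  init x := PMF.pure ((x, []), .empty)
  step
    | (x, l), .launch M d' =>
        if IsNoninteractiveDP D adj d' M then
          (M x).map fun m => ((x, l ++ [d']), .message m)
        else PMF.pure ((x, l), .notPrivate)
    | (x, l), .privacyLoss => PMF.pure ((x, l), .loss (G l))
    | (x, l), .other _ => PMF.pure ((x, l), .invalidQuery)
  lossQuery := .privacyLoss
  lossAnswer := .loss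
  lossAnswer_injective _ _ h := Answer.loss.inj h
  loss s := G s.2
  step_lossQuery _ := rfl

/-- `G` is a valid `𝒟` DP NIM-privacy-loss accumulator. -/
def IsValidNIMAccumulator (G : List 𝒟 → 𝒟) : Prop :=
  IsValidOdometer D adj (odomNIM D adj G)

/-! ### Concurrent interactive setting -/

/-- Start `M` with parameter `d'` in a composition of the mechanisms `l` on the dataset `x`. -/
def launchIM (x : X) (l : List (Launched 𝒟 X)) (M : IM X) (d' : 𝒟) :
    PMF ((X × List (Launched 𝒟 X)) × Answer 𝒟) :=
  (M.init x).map fun p => ((x, l ++ [⟨M, d', p.1⟩]), .message p.2)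

/-- Send `q` to the mechanism with index `j` in a composition of the mechanisms `l`. -/
def askIM (x : X) (l : List (Launched 𝒟 X)) (j : ℕ) (q : Str) :
    PMF ((X × List (Launched 𝒟 X)) × Answer 𝒟) :=
  match l[j]? with
  | some c => (c.mech.step c.state q).map fun p =>
      ((x, l.set j ⟨c.mech, c.param, p.1⟩), .message p.2)
  | none => PMF.pure ((x, l), .invalidQuery)

open Classical in
/-- `F(·; d)-FiltCon(IM)`. A state is a dataset with the list of mechanisms launched so far, or
`none` for `Halt`. -/
def filtConIM (F : List 𝒟 → 𝒟 → Bool) (d : 𝒟) :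
    Mechanism.{1, 1} X (IMQuery 𝒟 X) (Answer 𝒟) where
  State := Option (X × List (Launched 𝒟 X))
  init x := PMF.pure (some (x, []), .empty)
  step
    | none, _ => PMF.pure (none, .halted)
    | some (x, l), .launch M d' =>
        if IsDP D adj d' M then
          if F (l.map Launched.param ++ [d']) d = true then
            (launchIM x l M d').map fun p => (some p.1, p.2)
          else PMF.pure (none, .insufficientBudget)
        else PMF.pure (some (x, l), .notPrivate)
    | some (x, l), .ask j q => (askIM x l j q).map fun p => (some p.1, p.2)
    | some (x, l), .privacyLoss => PMF.pure (some (x, l), .invalidQuery)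
    | some (x, l), .other _ => PMF.pure (some (x, l), .invalidQuery)

/-- `F` is a valid `𝒟` DP concurrent IM-filter. -/
def IsValidIMFilter (F : List 𝒟 → 𝒟 → Bool) : Prop :=
  ∀ d : 𝒟, IsDP D adj d (filtConIM D adj F d)

open Classical in
/-- `G-OdomCon(IM)`. -/
def odomConIM (G : List 𝒟 → 𝒟) : Odometer.{1, 1} 𝒟 X (IMQuery 𝒟 X) (Answer 𝒟) where
  State := X × List (Launched 𝒟 X)
  init x := PMF.pure ((x, []), .empty)
  step
    | (x, l), .launch M d' =>
        if IsDP D adj d' M then launchIM x l M d'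
        else PMF.pure ((x, l), .notPrivate)
    | (x, l), .ask j q => askIM x l j q
    | (x, l), .privacyLoss => PMF.pure ((x, l), .loss (G (l.map Launched.param)))
    | (x, l), .other _ => PMF.pure ((x, l), .invalidQuery)
  lossQuery := .privacyLoss
  lossAnswer := .loss
  lossAnswer_injective _ _ h := Answer.loss.inj h
  loss s := G (s.2.map Launched.param)
  step_lossQuery _ := rfl

/-- `G` is a valid `𝒟` DP concurrent IM-privacy-loss accumulator. -/
def IsValidIMAccumulator (G : List 𝒟 → 𝒟) : Prop :=
  IsValidOdometer D adj (odomConIM D adj G)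

end Privacy

end

end ConcurrentDP

/-! The filter with budget `d` and the odometer do the same thing until a launch makes `G` of the
declared parameters fail `≤ d`. At that moment the truncated view of the odometer ends and the
filter halts. So the view of either one is a postprocessing of the view of the other under a
modified adversary, and bounds on distances transfer. `RunsUpTo` collects what the noninteractive
and the concurrent setting share, so that both parts are one argument.

The modified adversary `replayAdversary` acts like `𝒜`, but until the mechanism stops its coins
encode the whole history of coins and answers. A single entry of its view then determines the
parameters used, the pending query and the answer, so the view of `𝒜` can be rebuilt entry by entry.

From filter to odometer (`truncatedView_eq_map`): the filter calls a privacy-loss query invalid, but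
the loss is a function of the history and can be filled in; the refusal of a launch becomes the end
of the view. From odometer to filter (`view_eq_bind_splice`): after a refusal `𝒜` may keep tossing
coins, but the law of this tail depends on the history and not on the dataset. The view of the
filter is therefore the truncated view spliced with independent random tails, and joint convexity
allows such a seed (`postprocessing_seed`).

If `G [] ≤ d` fails, the truncated view is trivial, and `G [] ≤ G [d']` forces the filter to refuse
every private launch. In both cases the two laws to be compared are equal, and `dist_self_le`
applies.

All equalities of laws come from `eq_of_recursion`: both sides obey the same one-step recursion
along a common process, here `Sim`, so they agree on boxes by induction on the length. -/

namespace ConcurrentDP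

noncomputable section

/-! ### Laws of sequences -/

section Sequences

/-- The sequence that starts with `e` and goes on with `v`. -/
def consSeq {E : Type*} (e : E) (v : ℕ → E) : ℕ → E
  | 0 => e
  | n + 1 => v n

theorem measurable_consSeq {E : Type*} [MeasurableSpace E] (e : E) :
    Measurable (consSeq e : (ℕ → E) → ℕ → E) := by
  refine measurable_pi_lambda _ fun n => ?_
  cases n with
  | zero => exact measurable_const
  | succ n => exact measurable_pi_apply n

/-- The sequences whose first `n` terms lie in the sets `B 0, B 1, …`. -/
def box {E : Type*} (n : ℕ) (B : ℕ → Set E) : Set (ℕ → E) :=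
  {v | ∀ i < n, v i ∈ B i}

theorem measurableSet_box {E : Type*} [MeasurableSpace E] (n : ℕ) {B : ℕ → Set E}
    (hB : ∀ i, MeasurableSet (B i)) : MeasurableSet (box n B) := by
  have : box n B = ⋂ i, ⋂ (_ : i < n), (fun v : ℕ → E => v i) ⁻¹' B i := by
    ext v; simp [box]
  rw [this]
  exact .iInter fun i => .iInter fun _ => measurable_pi_apply i (hB i)

theorem consSeq_mem_box {E : Type*} {n : ℕ} {B : ℕ → Set E} {e : E} {v : ℕ → E} :
    consSeq e v ∈ box (n + 1) B ↔ e ∈ B 0 ∧ v ∈ box n fun i => B (i + 1) := by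
  constructor
  · exact fun h => ⟨h 0 n.succ_pos, fun i hi => h (i + 1) (Nat.succ_lt_succ hi)⟩
  · rintro ⟨h0, h⟩ i hi
    cases i with
    | zero => exact h0
    | succ i => exact h i (Nat.lt_of_succ_lt_succ hi)

/-- Square cylinders form a generating π-system, and each of them is a box: pad with `Set.univ` up
to the largest index involved. -/
theorem measure_eq_of_box {E : Type*} [MeasurableSpace E] {μ ν : Measure (ℕ → E)}
    [IsProbabilityMeasure μ] [IsProbabilityMeasure ν]
    (h : ∀ n (B : ℕ → Set E), (∀ i, MeasurableSet (B i)) → μ (box n B) = ν (box n B)) :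
    μ = ν := by
  classical
  refine ext_of_generate_finite
    (squareCylinders fun _ : ℕ => {s : Set E | MeasurableSet s})
    (generateFrom_squareCylinders (α := fun _ : ℕ => E)).symm
    (isPiSystem_squareCylinders (fun _ => MeasurableSpace.isPiSystem_measurableSet)
      fun _ => MeasurableSet.univ) ?_ (by simp)
  rintro _ ⟨s, t, ht, rfl⟩
  have key : (s : Set ℕ).pi t = box (s.sup id + 1) fun i => if i ∈ s then t i else Set.univ := by
    ext v
    constructor
    · intro hv i _
      by_cases hi : i ∈ s
      · simpa [hi] using hv i hi
      · simp [hi]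
    · intro hv i hi
      have hi' : i ∈ s := hi
      simpa [hi'] using hv i (Nat.lt_succ_of_le (Finset.le_sup (f := id) hi'))
  rw [key]
  refine h _ _ fun i => ?_
  by_cases hi : i ∈ s
  · simpa [hi] using ht i (Set.mem_univ i)
  · simp [hi]

/-- If two families of laws satisfy, at each index of an invariant set, the same one-step
recursion or else agree, then they agree on this set. -/
theorem eq_of_recursion {J E : Type*} [MeasurableSpace J] [DiscreteMeasurableSpace J]
    [MeasurableSpace E] (inv : J → Prop) (p : J → PMF J) (μ ν : J → Measure (ℕ → E))
    [∀ j, IsProbabilityMeasure (μ j)] [∀ j, IsProbabilityMeasure (ν j)]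
    (h : ∀ j, inv j → μ j = ν j ∨ ∃ e, (∀ j' ∈ (p j).support, inv j') ∧
      μ j = ((p j).toMeasure.bind μ).map (consSeq e) ∧
      ν j = ((p j).toMeasure.bind ν).map (consSeq e)) (j : J) (hj : inv j) : μ j = ν j := by
  refine measure_eq_of_box fun n => ?_
  induction n generalizing j with
  | zero => intro B _; simp [box]
  | succ n ih =>
    intro B hB
    rcases h j hj with h | ⟨e, hinv, hμ, hν⟩
    · rw [h]
    · have hpre : consSeq e ⁻¹' box (n + 1) B =
          {v | e ∈ B 0 ∧ v ∈ box n fun i => B (i + 1)} := by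
        ext v; exact consSeq_mem_box
      rw [hμ, hν, Measure.map_apply (measurable_consSeq e) (measurableSet_box _ hB),
        Measure.map_apply (measurable_consSeq e) (measurableSet_box _ hB), hpre]
      by_cases he : e ∈ B 0
      · simp only [he, true_and, Set.ofPred_mem_eq]
        have hm := measurableSet_box n fun i => hB (i + 1)
        rw [Measure.bind_apply hm Measurable.of_discrete.aemeasurable,
          Measure.bind_apply hm Measurable.of_discrete.aemeasurable]
        refine lintegral_congr_ae ?_
        -- The invariant is known only on the support of `p j`, so the integrands are compared
        -- almost everywhere.
        have hsupp : ∀ᵐ j' ∂(p j).toMeasure, j' ∈ (p j).support := by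
          rw [ae_iff]
          exact ((p j).toMeasure_apply_eq_zero_iff (.of_discrete)).2
            (Set.disjoint_left.2 fun a ha ha' => ha' ha)
        filter_upwards [hsupp] with j' hj'
        exact ih j' (hinv j' hj') _ fun i => hB (i + 1)
      · simp [he]

end Sequences

/-! ### Markov chains with discrete states -/

section Chains

universe v
variable {S : Type v} [MeasurableSpace S] (next : S → PMF S)

/-- The expectation of `f 0 s * f 1 (ω 1) * ⋯ * f n (ω n)` for the chain started in `s`. -/
def chainExpectation : ℕ → (ℕ → S → ENNReal) → S → ENNReal
  | 0, f, s => f 0 s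
  | n + 1, f, s =>
    f 0 s * ∫⁻ s', chainExpectation n (fun i => f (i + 1)) s' ∂(next s).toMeasure

/-- The definition splits off the first factor, whereas the trajectory measure is extended at its
last coordinate. Integrating out the last factor into the previous one reconciles the two. -/
theorem chainExpectation_succ (n : ℕ) (f : ℕ → S → ENNReal) (s : S) :
    chainExpectation next (n + 1) f s =
      chainExpectation next n
        (fun i s =>
          if i = n then f n s * ∫⁻ s', f (n + 1) s' ∂(next s).toMeasure else f i s) s := by
  induction n generalizing f s with
  | zero => simp [chainExpectation]
  | succ n ih =>
    rw [chainExpectation, chainExpectation]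
    simp only [ih, Nat.add_right_cancel_iff]
    simp

variable [DiscreteMeasurableSpace S]

/-- The law of a discrete-state Markov chain with the given law of the first state. -/
def chainMeasure (μ : Measure S) : Measure (ℕ → S) :=
  Kernel.trajMeasure (X := fun _ => S) μ (chainKernel next)

instance instIsProbabilityMeasureChainMeasure (μ : Measure S) [IsProbabilityMeasure μ] :
    IsProbabilityMeasure (chainMeasure next μ) := by
  unfold chainMeasure
  infer_instance

theorem map_eval_zero_chainMeasure (μ : Measure S) [IsProbabilityMeasure μ] :
    (chainMeasure next μ).map (fun ω => ω 0) = μ := by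
  let κ : (n : ℕ) → Kernel (∀ _ : Finset.Iic n, S) S := chainKernel next
  have h0 : (fun ω : ℕ → S => ω 0) =
      (fun h : (i : Finset.Iic 0) → S => h ⟨0, Finset.mem_Iic.2 le_rfl⟩) ∘
        Preorder.frestrictLe (π := fun _ : ℕ => S) 0 := rfl
  have hm : Measurable (fun h : (i : Finset.Iic 0) → S => h ⟨0, Finset.mem_Iic.2 le_rfl⟩) :=
    measurable_pi_apply _
  rw [h0, ← Measure.map_map hm (Preorder.measurable_frestrictLe 0)]
  have h1 : (chainMeasure next μ).map (Preorder.frestrictLe (π := fun _ : ℕ => S) 0) =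
      μ.map (MeasurableEquiv.piUnique fun _ : Finset.Iic 0 => S).symm := by
    rw [chainMeasure, Kernel.trajMeasure, Measure.map_comp _ _ (Preorder.measurable_frestrictLe 0),
      Kernel.traj_map_frestrictLe, Kernel.partialTraj_self, Measure.id_comp]
  rw [h1, Measure.map_map hm (MeasurableEquiv.measurable _)]
  exact Measure.map_id

/-- Induction on `n`: disintegrate the law of the first `n + 2` states along the last transition,
integrate out the last state, and absorb the result into the factor with index `n`. -/
theorem lintegral_prod_chainMeasure (μ : Measure S) [IsProbabilityMeasure μ] (n : ℕ)
    (f : ℕ → S → ENNReal) :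
    ∫⁻ ω, ∏ i ∈ Finset.range (n + 1), f i (ω i) ∂(chainMeasure next μ) =
      ∫⁻ s, chainExpectation next n f s ∂μ := by
  have hf : ∀ i, Measurable (f i) := fun i => .of_discrete
  induction n generalizing f with
  | zero =>
    conv_rhs => rw [← map_eval_zero_chainMeasure next μ]
    rw [lintegral_map .of_discrete (measurable_pi_apply 0)]
    simp [chainExpectation]
  | succ n ih =>
    have key := Kernel.map_frestrictLe_trajMeasure_compProd_eq_map_trajMeasure
      (X := fun _ => S) (κ := chainKernel next) (μ₀ := μ) (a := n)
    rw [← chainMeasure] at key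
    let P : ((i : Finset.Iic n) → S) → ENNReal := fun h => ∏ i : Finset.Iic n, f i (h i)
    let g : S → ENNReal := fun s => ∫⁻ s', f (n + 1) s' ∂(next s).toMeasure
    have hP : Measurable P :=
      Finset.measurable_prod _ fun i _ => (hf i).comp (measurable_pi_apply i)
    have hF : Measurable fun q : ((i : Finset.Iic n) → S) × S => P q.1 * f (n + 1) q.2 :=
      (hP.comp measurable_fst).mul ((hf (n + 1)).comp measurable_snd)
    have hg : Measurable fun h : (i : Finset.Iic n) → S =>
        P h * g (h ⟨n, Finset.mem_Iic.2 le_rfl⟩) :=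
      hP.mul ((Measurable.of_discrete (f := g)).comp (measurable_pi_apply _))
    have hPr : ∀ ω : ℕ → S, P (Preorder.frestrictLe (π := fun _ => S) n ω) =
        ∏ i ∈ Finset.range (n + 1), f i (ω i) := by
      intro ω
      have : Finset.range (n + 1) = Finset.Iic n := by ext; simp
      rw [this, ← Finset.prod_coe_sort]
      rfl
    calc ∫⁻ ω, ∏ i ∈ Finset.range (n + 1 + 1), f i (ω i) ∂(chainMeasure next μ)
        = ∫⁻ q, P q.1 * f (n + 1) q.2 ∂((chainMeasure next μ).map
            fun x => (Preorder.frestrictLe (π := fun _ : ℕ => S) n x, x (n + 1))) := by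
          rw [lintegral_map hF
            ((Preorder.measurable_frestrictLe n).prodMk (measurable_pi_apply (n + 1)))]
          simp only [hPr, Finset.prod_range_succ _ (n + 1)]
      _ = ∫⁻ h, P h * g (h ⟨n, Finset.mem_Iic.2 le_rfl⟩)
            ∂((chainMeasure next μ).map (Preorder.frestrictLe (π := fun _ : ℕ => S) n)) := by
          rw [← key, Measure.lintegral_compProd hF]
          refine lintegral_congr fun h => ?_
          exact lintegral_const_mul (P h) (hf (n + 1))
      _ = ∫⁻ ω, ∏ i ∈ Finset.range (n + 1),
            (if i = n then f n (ω i) * g (ω i) else f i (ω i)) ∂(chainMeasure next μ) := by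
          rw [lintegral_map hg (Preorder.measurable_frestrictLe n)]
          refine lintegral_congr fun ω => ?_
          rw [hPr, Finset.prod_range_succ, Finset.prod_range_succ, mul_assoc]
          congr 1
          · refine Finset.prod_congr rfl fun i hi => ?_
            rw [if_neg (Finset.mem_range.1 hi).ne]
          · simp
      _ = _ := by
          rw [ih (fun i s => if i = n then f n s * g s else f i s) fun _ => .of_discrete]
          simp only [chainExpectation_succ, g]

theorem chainMeasure_box (μ : Measure S) [IsProbabilityMeasure μ] (n : ℕ) (B : ℕ → Set S) :
    chainMeasure next μ (box (n + 1) B) =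
      ∫⁻ s, chainExpectation next n (fun i => (B i).indicator 1) s ∂μ := by
  have h1 : ∀ ω : ℕ → S, ∏ i ∈ Finset.range (n + 1), (B i).indicator (1 : S → ENNReal) (ω i) =
      (box (n + 1) B).indicator 1 ω := by
    intro ω
    by_cases h : ω ∈ box (n + 1) B
    · rw [Set.indicator_of_mem h]
      exact Finset.prod_eq_one fun i hi => Set.indicator_of_mem (h i (Finset.mem_range.1 hi)) 1
    · rw [Set.indicator_of_notMem h]
      simp only [box, Set.mem_ofPred_eq, not_forall] at h
      obtain ⟨i, hi, hB⟩ := h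
      exact Finset.prod_eq_zero (Finset.mem_range.2 hi) (Set.indicator_of_notMem hB 1)
  rw [← lintegral_prod_chainMeasure]
  simp only [h1]
  rw [lintegral_indicator_one (measurableSet_box _ fun _ => .of_discrete)]

/-- The law of the sequence of the values of `e` along the chain started in `s`. -/
def traceLaw {E : Type*} [MeasurableSpace E] (e : S → E) (s : S) : Measure (ℕ → E) :=
  (chainMeasure next (Measure.dirac s)).map fun ω n => e (ω n)

theorem measurable_trace {E : Type*} [MeasurableSpace E] (e : S → E) :
    Measurable (fun (ω : ℕ → S) (n : ℕ) => e (ω n)) :=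
  measurable_pi_lambda _ fun n => (Measurable.of_discrete (f := e)).comp (measurable_pi_apply n)

instance instIsProbabilityMeasureTraceLaw {E : Type*} [MeasurableSpace E] (e : S → E) (s : S) :
    IsProbabilityMeasure (traceLaw next e s) :=
  Measure.isProbabilityMeasure_map (measurable_trace e).aemeasurable

theorem isProbabilityMeasure_bind {α β : Type*} [MeasurableSpace α] [MeasurableSpace β]
    (μ : Measure α) [IsProbabilityMeasure μ] (f : α → Measure β) [∀ a, IsProbabilityMeasure (f a)]
    (hf : Measurable f) : IsProbabilityMeasure (μ.bind f) :=
  ⟨by rw [Measure.bind_apply .univ hf.aemeasurable]; simp⟩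

/-- On boxes, `chainMeasure_box` is an integral against the initial law, hence a mixture over
starting points. -/
theorem chainMeasure_eq_bind (μ : Measure S) [IsProbabilityMeasure μ] :
    chainMeasure next μ = μ.bind fun s => chainMeasure next (Measure.dirac s) := by
  have := isProbabilityMeasure_bind μ (fun s => chainMeasure next (Measure.dirac s)) .of_discrete
  refine measure_eq_of_box fun n B hB => ?_
  cases n with
  | zero => simp [box]
  | succ n =>
    rw [Measure.bind_apply (measurableSet_box _ hB) Measurable.of_discrete.aemeasurable,
      chainMeasure_box]
    simp only [chainMeasure_box, lintegral_dirac]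

/-- The Markov property at time one. On boxes it is the recursion that defines `chainExpectation`,
the first factor being the indicator of `s ∈ B 0`. -/
theorem chainMeasure_dirac (s : S) :
    chainMeasure next (Measure.dirac s) =
      (chainMeasure next (next s).toMeasure).map (consSeq s) := by
  have : IsProbabilityMeasure ((chainMeasure next (next s).toMeasure).map (consSeq s)) :=
    Measure.isProbabilityMeasure_map (measurable_consSeq s).aemeasurable
  refine measure_eq_of_box fun n B hB => ?_
  cases n with
  | zero => simp [box]
  | succ n =>
    have hpre : consSeq s ⁻¹' box (n + 1) B = {v | s ∈ B 0 ∧ v ∈ box n fun i => B (i + 1)} := by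
      ext v; exact consSeq_mem_box
    rw [Measure.map_apply (measurable_consSeq s) (measurableSet_box _ hB), hpre, chainMeasure_box,
      lintegral_dirac]
    by_cases hs : s ∈ B 0
    · simp only [hs, true_and, Set.ofPred_mem_eq]
      cases n with
      | zero => simp [box, chainExpectation, hs]
      | succ n => rw [chainMeasure_box, chainExpectation, Set.indicator_of_mem hs]; simp
    · cases n <;> simp [chainExpectation, hs]

theorem map_trace_chainMeasure {E : Type*} [MeasurableSpace E] (e : S → E) (μ : Measure S)
    [IsProbabilityMeasure μ] :
    (chainMeasure next μ).map (fun ω n => e (ω n)) = μ.bind (traceLaw next e) := by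
  have hm : Measurable fun ω : ℕ → S => Measure.dirac fun n => e (ω n) :=
    Measure.measurable_dirac.comp (measurable_trace e)
  rw [chainMeasure_eq_bind, ← Measure.bind_dirac_eq_map _ (measurable_trace e),
    Measure.bind_bind Measurable.of_discrete.aemeasurable hm.aemeasurable]
  simp only [Measure.bind_dirac_eq_map _ (measurable_trace e)]
  rfl

/-- This is the one-step recursion in the form that `eq_of_recursion` takes. -/
theorem traceLaw_eq {E : Type*} [MeasurableSpace E] (e : S → E) (s : S) :
    traceLaw next e s = ((next s).toMeasure.bind (traceLaw next e)).map (consSeq (e s)) := by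
  rw [← map_trace_chainMeasure, traceLaw, chainMeasure_dirac,
    Measure.map_map (measurable_trace e) (measurable_consSeq s),
    Measure.map_map (measurable_consSeq (e s)) (measurable_trace e)]
  congr 1
  funext ω n
  cases n <;> rfl

end Chains

/-! ### Composition of laws -/

section Composition

theorem map_bind_measure {α β δ : Type*} [MeasurableSpace α] [MeasurableSpace β]
    [MeasurableSpace δ] (μ : Measure α) {f : α → Measure β} (hf : Measurable f) {g : β → δ}
    (hg : Measurable g) : (μ.bind f).map g = μ.bind fun a => (f a).map g := by
  have hm : Measurable fun b => Measure.dirac (g b) := Measure.measurable_dirac.comp hg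
  rw [← Measure.bind_dirac_eq_map _ hg, Measure.bind_bind hf.aemeasurable hm.aemeasurable]
  refine congrArg _ (funext fun a => ?_)
  exact Measure.bind_dirac_eq_map _ hg

theorem bind_map_measure {α β δ : Type*} [MeasurableSpace α] [MeasurableSpace β]
    [MeasurableSpace δ] (μ : Measure α) {φ : α → β} (hφ : Measurable φ) {f : β → Measure δ}
    (hf : Measurable f) : (μ.map φ).bind f = μ.bind fun a => f (φ a) := by
  have hm : Measurable fun a => Measure.dirac (φ a) := Measure.measurable_dirac.comp hφ
  rw [← Measure.bind_dirac_eq_map _ hφ, Measure.bind_bind hm.aemeasurable hf.aemeasurable]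
  refine congrArg _ (funext fun a => ?_)
  exact Measure.dirac_bind hf _

universe w w₁ w₂

/-- Two chains that are images of a common process yield traces that are related by an entrywise
map. -/
theorem traceLaw_eq_map_of_coupling {J : Type w} {S₁ : Type w₁} {S₂ : Type w₂}
    [MeasurableSpace S₁] [DiscreteMeasurableSpace S₁]
    [MeasurableSpace S₂] [DiscreteMeasurableSpace S₂] {E₁ E₂ : Type*} [MeasurableSpace E₁]
    [MeasurableSpace E₂] (next₁ : S₁ → PMF S₁) (next₂ : S₂ → PMF S₂) (e₁ : S₁ → E₁)
    (e₂ : S₂ → E₂) (γ : E₁ → E₂) (hγ : Measurable γ) (inv : J → Prop) (p : J → PMF J)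
    (φ₁ : J → S₁) (φ₂ : J → S₂)
    (hinv : ∀ j, inv j → ∀ j' ∈ (p j).support, inv j')
    (h₁ : ∀ j, inv j → next₁ (φ₁ j) = (p j).map φ₁)
    (h₂ : ∀ j, inv j → next₂ (φ₂ j) = (p j).map φ₂)
    (he : ∀ j, inv j → e₂ (φ₂ j) = γ (e₁ (φ₁ j))) (j : J) (hj : inv j) :
    traceLaw next₂ e₂ (φ₂ j) = (traceLaw next₁ e₁ (φ₁ j)).map fun v n => γ (v n) := by
  let _ : MeasurableSpace J := ⊤
  have hΓ : Measurable fun (v : ℕ → E₁) (n : ℕ) => γ (v n) :=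
    measurable_pi_lambda _ fun n => hγ.comp (measurable_pi_apply n)
  have : ∀ j, IsProbabilityMeasure ((traceLaw next₁ e₁ (φ₁ j)).map fun v n => γ (v n)) :=
    fun j => Measure.isProbabilityMeasure_map hΓ.aemeasurable
  -- Only one-step laws are coupled: both transitions are images of `p j`, and an entrywise map
  -- commutes with prepending an entry.
  refine eq_of_recursion inv p (fun j => traceLaw next₂ e₂ (φ₂ j))
    (fun j => (traceLaw next₁ e₁ (φ₁ j)).map fun v n => γ (v n))
    (fun j hj => .inr ⟨e₂ (φ₂ j), hinv j hj, ?_, ?_⟩) j hj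
  · rw [traceLaw_eq, h₂ j hj, ← PMF.toMeasure_map _ _ Measurable.of_discrete,
      bind_map_measure _ .of_discrete .of_discrete]
  · rw [traceLaw_eq, h₁ j hj, ← PMF.toMeasure_map _ _ Measurable.of_discrete,
      bind_map_measure _ .of_discrete .of_discrete, ← map_bind_measure _ .of_discrete hΓ,
      Measure.map_map hΓ (measurable_consSeq _), Measure.map_map (measurable_consSeq _) hΓ]
    congr 1
    funext v n
    cases n with
    | zero => exact (he j hj).symm
    | succ n => rfl

end Composition

/-! ### Closure properties of distances -/

section Distances

variable {𝒟 : Type} [PartialOrder 𝒟] (D : GeneralizedDistance 𝒟)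

/-- The poset need not have a least element, so equal laws are handled by comparison with some known
bound. Constant maps send `μ` and `ν` to the same Dirac law, which bounds the distance of each Dirac
law from itself; joint convexity with index law `ρ` then mixes the Dirac laws into `ρ`. -/
theorem GeneralizedDistance.dist_self_le {Ω Ω' : Type} [MeasurableSpace Ω] [MeasurableSpace Ω']
    {μ ν : ProbabilityMeasure Ω} {d : 𝒟} (h : D.dist μ ν ≤ d) (ρ : ProbabilityMeasure Ω') :
    D.dist ρ ρ ≤ d := by
  have hd : ∀ a : Ω', D.dist (Ω := Ω') ⟨Kernel.id a, inferInstance⟩ ⟨Kernel.id a, inferInstance⟩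
      ≤ d := by
    intro a
    have hc : ∀ μ : ProbabilityMeasure Ω,
        μ.map (measurable_const (a := a)).aemeasurable = ⟨Kernel.id a, inferInstance⟩ := by
      intro μ
      apply Subtype.ext
      change (μ : Measure Ω).map (fun _ => a) = _
      rw [Measure.map_const, measure_univ, one_smul]
      exact (Kernel.id_apply a).symm
    have := D.postprocessing (fun _ => a) measurable_const μ ν
    rw [hc, hc] at this
    exact this.trans h
  have hρ : (⟨Kernel.id ∘ₘ (ρ : Measure Ω'), inferInstance⟩ : ProbabilityMeasure Ω') = ρ :=
    Subtype.ext Measure.id_comp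
  have := D.joint_convexity Kernel.id Kernel.id ρ d hd
  rwa [hρ] at this

/-- Closure under postprocessing with an independent random seed. -/
theorem GeneralizedDistance.postprocessing_seed {Ω Ω' W : Type} [MeasurableSpace Ω]
    [MeasurableSpace Ω'] [MeasurableSpace W] (g : Ω → W → Ω') (hg : Measurable (Function.uncurry g))
    (ρ : Measure W) [IsProbabilityMeasure ρ] (μ μ' : ProbabilityMeasure Ω)
    (ν ν' : ProbabilityMeasure Ω')
    (hν : (ν : Measure Ω') = (μ : Measure Ω).bind fun v => ρ.map (g v))
    (hν' : (ν' : Measure Ω') = (μ' : Measure Ω).bind fun v => ρ.map (g v)) :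
    D.dist ν ν' ≤ D.dist μ μ' := by
  have hg₁ : ∀ v, Measurable (g v) := fun v => hg.comp measurable_prodMk_left
  have hg₂ : ∀ w, Measurable fun v => g v w := fun w => hg.comp measurable_prodMk_right
  have hm : ∀ μ : ProbabilityMeasure Ω, Measurable fun w => (μ : Measure Ω).map fun v => g v w := by
    intro μ
    have : (fun w => (μ : Measure Ω).map fun v => g v w) =
        fun w => ((μ : Measure Ω).map fun v => (v, w)).map (Function.uncurry g) := by
      funext w
      rw [Measure.map_map hg measurable_prodMk_right]
      rfl
    rw [this]
    exact (Measure.measurable_map _ hg).comp Measurable.map_prodMk_right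
  let κ : ProbabilityMeasure Ω → Kernel W Ω' := fun μ => ⟨_, hm μ⟩
  have hκ : ∀ μ, IsMarkovKernel (κ μ) := fun μ =>
    ⟨fun w => Measure.isProbabilityMeasure_map (hg₂ w).aemeasurable⟩
  -- Fubini: drawing the seed first, for which each fixed seed gives a deterministic postprocessing,
  -- yields the same law as drawing it last.
  have key : ∀ μ : ProbabilityMeasure Ω,
      (κ μ) ∘ₘ ρ = (μ : Measure Ω).bind fun v => ρ.map (g v) := by
    intro μ
    have hsw : Measurable fun q : W × Ω => g q.2 q.1 := hg.comp measurable_swap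
    have h₁ : (κ μ) ∘ₘ ρ = (ρ.prod (μ : Measure Ω)).map fun q => g q.2 q.1 := by
      rw [Measure.prod, map_bind_measure _ Measurable.map_prodMk_left hsw]
      refine congrArg _ (funext fun w => ?_)
      rw [Measure.map_map hsw measurable_prodMk_left]
      rfl
    have h₂ : ((μ : Measure Ω).bind fun v => ρ.map (g v)) =
        ((μ : Measure Ω).prod ρ).map (Function.uncurry g) := by
      rw [Measure.prod, map_bind_measure _ Measurable.map_prodMk_left hg]
      refine congrArg _ (funext fun v => ?_)
      rw [Measure.map_map hg measurable_prodMk_left]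
      rfl
    rw [h₁, h₂, ← Measure.prod_swap, Measure.map_map hsw measurable_swap]
    rfl
  have hdist := D.joint_convexity (κ μ) (κ μ') ⟨ρ, inferInstance⟩ (D.dist μ μ')
    fun w => D.postprocessing (fun v => g v w) (hg₂ w) μ μ'
  have e₁ : (⟨κ μ ∘ₘ ρ, inferInstance⟩ : ProbabilityMeasure Ω') = ν :=
    Subtype.ext ((key μ).trans hν.symm)
  have e₂ : (⟨κ μ' ∘ₘ ρ, inferInstance⟩ : ProbabilityMeasure Ω') = ν' :=
    Subtype.ext ((key μ').trans hν'.symm)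
  change D.dist ⟨κ μ ∘ₘ ρ, inferInstance⟩ ⟨κ μ' ∘ₘ ρ, inferInstance⟩ ≤ _ at hdist
  rwa [e₁, e₂] at hdist

end Distances

/-! ### Views -/

section Views

universe u v v'

variable {X : Type} {Q : Type u} {A : Type}

/-- The law of the entries from a given stage on. -/
abbrev entriesFrom (𝒜 : Adversary Q A) (M : Mechanism.{u, v} X Q A) (cut : M.State → Prop)
    (z : Stage M.State 𝒜.State A) : Measure (View A) :=
  traceLaw (nextStage 𝒜 M cut) (fun z : Stage M.State 𝒜.State A => (z.2 : Entry A)) z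

theorem coe_stoppedView (𝒜 : Adversary Q A) (M : Mechanism.{u, v} X Q A)
    (cut : M.State → Prop) (x : X) :
    (stoppedView 𝒜 M cut x : Measure (View A)) =
      (firstStage 𝒜 M cut x).toMeasure.bind (entriesFrom 𝒜 M cut) := by
  change (stagesLaw 𝒜 M cut x).map _ = _
  exact map_trace_chainMeasure (nextStage 𝒜 M cut) (fun z => z.2) _

theorem coe_stoppedView_of_init_eq_pure (𝒜 : Adversary Q A) (M : Mechanism.{u, v} X Q A)
    (cut : M.State → Prop) (x : X) {s : M.State} {a : A} (h : M.init x = PMF.pure (s, a)) :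
    (stoppedView 𝒜 M cut x : Measure (View A)) =
      entriesFrom 𝒜 M cut (deliver cut 𝒜.start [] s a) := by
  rw [coe_stoppedView, firstStage, h, PMF.pure_map, PMF.toMeasure_pure,
    Measure.dirac_bind .of_discrete]

/-- The stage with the given continuation and entry. -/
def mkStage {S : Type v} {T : Type} (o : Option (S × T × A)) (e : Entry A) : Stage S T A := (o, e)

/-- The entry of a round with coins `r` that is answered by `a`. -/
def msgEntry (r : Str) (a : A) : Entry A := some (r, some a)

/-- The entry of a round with coins `r` that is not answered. -/
def endEntry (r : Str) : Entry A := some (r, none)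

/-- The entry after the end of a view. -/
def noEntry : Entry A := none

/-- The next stage, given the coins `r` of the adversary. -/
def respond (𝒜 : Adversary Q A) (M : Mechanism.{u, v} X Q A) (cut : M.State → Prop)
    (s : M.State) (r : Str) (t : 𝒜.State) : Option Q → PMF (Stage M.State 𝒜.State A)
  | none => PMF.pure (mkStage none (endEntry r))
  | some q => (M.step s q).map fun p => deliver cut t r p.1 p.2

theorem nextStage_some (𝒜 : Adversary Q A) (M : Mechanism.{u, v} X Q A)
    (cut : M.State → Prop) (s : M.State) (t : 𝒜.State) (a : A) (e : Entry A) :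
    nextStage 𝒜 M cut (mkStage (some (s, t, a)) e) = (𝒜.coins t a).bind fun r =>
      respond 𝒜 M cut s r (𝒜.act t a r).1 (𝒜.act t a r).2 := by
  refine congrArg (PMF.bind (𝒜.coins t a)) (funext fun r => ?_)
  rcases 𝒜.act t a r with ⟨t', _ | q⟩ <;> rfl

theorem deliver_of_cut {S : Type v} {T : Type} {cut : S → Prop} {s : S} (h : cut s) (t : T)
    (r : Str) (a : A) : deliver cut t r s a = mkStage none (endEntry r) := if_pos h

theorem deliver_of_not_cut {S : Type v} {T : Type} {cut : S → Prop} {s : S} (h : ¬ cut s) (t : T)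
    (r : Str) (a : A) : deliver cut t r s a = mkStage (some (s, t, a)) (msgEntry r a) := if_neg h

/-- A map of mechanisms that commutes with initialization and steps preserves views. -/
theorem view_eq_of_semiconj {X' : Type} (𝒜 : Adversary Q A) (M : Mechanism.{u, v} X Q A)
    (M' : Mechanism.{u, v'} X' Q A) (ψ : M'.State → M.State) (x : X) (x' : X')
    (hinit : M.init x = (M'.init x').map fun p => (ψ p.1, p.2))
    (hstep : ∀ s q, M.step (ψ s) q = (M'.step s q).map fun p => (ψ p.1, p.2)) :
    view 𝒜 M x = view 𝒜 M' x' := by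
  let Φ : Stage M'.State 𝒜.State A → Stage M.State 𝒜.State A :=
    fun z => mkStage (z.1.map fun y => (ψ y.1, y.2)) z.2
  have hdel : ∀ t r (p : M'.State × A), deliver (fun _ => False) t r (ψ p.1) p.2 =
      Φ (deliver (fun _ => False) t r p.1 p.2) := by
    intro t r p
    rw [deliver_of_not_cut not_false, deliver_of_not_cut not_false]
    rfl
  have hnext : ∀ z, nextStage 𝒜 M (fun _ => False) (Φ z) =
      (nextStage 𝒜 M' (fun _ => False) z).map Φ := by
    rintro ⟨_ | ⟨s, t, a⟩, e⟩
    · exact (PMF.pure_map Φ (mkStage none noEntry)).symm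
    · change nextStage 𝒜 M (fun _ => False) (mkStage (some (ψ s, t, a)) e) =
        (nextStage 𝒜 M' (fun _ => False) (mkStage (some (s, t, a)) e)).map Φ
      rw [nextStage_some, nextStage_some, PMF.map_bind]
      refine congrArg _ (funext fun r => ?_)
      rcases (𝒜.act t a r).2 with _ | q
      · exact (PMF.pure_map Φ (mkStage none (endEntry r))).symm
      · simp only [respond, hstep, PMF.map_comp, Function.comp_def, hdel]
  have hentries : ∀ z, entriesFrom 𝒜 M (fun _ => False) (Φ z) =
      entriesFrom 𝒜 M' (fun _ => False) z := by
    intro z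
    -- The chain of stages of `M'` itself serves as the common process.
    have := traceLaw_eq_map_of_coupling (nextStage 𝒜 M' fun _ => False)
      (nextStage 𝒜 M fun _ => False) (fun z => (z.2 : Entry A)) (fun z => (z.2 : Entry A)) id
      measurable_id (fun _ => True) (nextStage 𝒜 M' fun _ => False) id Φ (fun _ _ _ _ => trivial)
      (fun z _ => (PMF.map_id _).symm) (fun z _ => hnext z) (fun _ _ => rfl) z trivial
    exact this.trans Measure.map_id
  apply Subtype.ext
  change (stoppedView 𝒜 M _ x : Measure (View A)) = (stoppedView 𝒜 M' _ x' : Measure (View A))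
  rw [coe_stoppedView, coe_stoppedView, firstStage, firstStage, hinit, PMF.map_comp]
  have : ((fun p : M.State × A => deliver (fun _ => False) 𝒜.start [] p.1 p.2) ∘
      fun p : M'.State × A => (ψ p.1, p.2)) =
      Φ ∘ fun p => deliver (fun _ => False) 𝒜.start [] p.1 p.2 :=
    funext fun p => hdel _ _ p
  rw [this, ← PMF.map_comp, ← PMF.toMeasure_map _ _ Measurable.of_discrete,
    bind_map_measure _ .of_discrete .of_discrete]
  simp only [hentries]

end Views

/-! ### Splicing of sequences -/

section Splicing

/-- Map the entries of `v` by `γ` up to the first entry that carries a code `c`; from this entry on,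
continue with the sequence `w c`. -/
def splice {E E' C : Type*} (code : E → Option C) (γ : E → E') :
    (ℕ → E) → (C → ℕ → E') → ℕ → E'
  | v, w, 0 => match code (v 0) with
    | some c => w c 0
    | none => γ (v 0)
  | v, w, n + 1 => match code (v 0) with
    | some c => w c (n + 1)
    | none => splice code γ (fun i => v (i + 1)) w n

theorem splice_consSeq_of_some {E E' C : Type*} {code : E → Option C} (γ : E → E') {e : E} {c : C}
    (h : code e = some c) (v : ℕ → E) (w : C → ℕ → E') :
    splice code γ (consSeq e v) w = w c := by
  funext n
  cases n <;> simp [splice, consSeq, h]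

theorem splice_consSeq_of_none {E E' C : Type*} {code : E → Option C} (γ : E → E') {e : E}
    (h : code e = none) (v : ℕ → E) (w : C → ℕ → E') :
    splice code γ (consSeq e v) w = consSeq (γ e) (splice code γ v w) := by
  funext n
  cases n <;> simp [splice, consSeq, h]

/-- Countability of `C` makes the evaluation of `w` at the random index `c` measurable, case by case
in the code. -/
theorem measurable_splice {E E' C : Type*} [MeasurableSpace E] [DiscreteMeasurableSpace E]
    [MeasurableSpace E'] [Countable C] (code : E → Option C) (γ : E → E') :
    Measurable (Function.uncurry (splice code γ)) := by
  let _ : MeasurableSpace (Option C) := ⊤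
  have : DiscreteMeasurableSpace (Option C) := ⟨fun _ => trivial⟩
  have hcode : Measurable fun q : (ℕ → E) × (C → ℕ → E') => code (q.1 0) :=
    (Measurable.of_discrete (f := code)).comp ((measurable_pi_apply 0).comp measurable_fst)
  have hcases : ∀ (n : ℕ) (f : (ℕ → E) × (C → ℕ → E') → E'), Measurable f →
      Measurable fun q : (ℕ → E) × (C → ℕ → E') => match code (q.1 0) with
        | some c => q.2 c n
        | none => f q := by
    intro n f hf
    have hF : Measurable fun y : Option C × ((ℕ → E) × (C → ℕ → E')) => match y.1 with
        | some c => y.2.2 c n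
        | none => f y.2 := by
      refine measurable_from_prod_countable_right fun o => ?_
      cases o with
      | none => exact hf
      | some c => exact (measurable_pi_apply n).comp ((measurable_pi_apply c).comp measurable_snd)
    exact hF.comp (hcode.prodMk measurable_id)
  refine measurable_pi_lambda _ fun n => ?_
  induction n with
  | zero =>
    exact hcases 0 (fun q => γ (q.1 0))
      ((Measurable.of_discrete (f := γ)).comp ((measurable_pi_apply 0).comp measurable_fst))
  | succ n ih =>
    refine hcases (n + 1) (fun q => splice code γ (fun i => q.1 (i + 1)) q.2 n) ?_
    have htail : Measurable fun q : (ℕ → E) × (C → ℕ → E') =>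
        ((fun i => q.1 (i + 1) : ℕ → E), q.2) :=
      (measurable_pi_lambda _ fun i => (measurable_pi_apply (i + 1)).comp
        measurable_fst).prodMk measurable_snd
    exact ih.comp htail

universe w w₁ w₂

/-- If two chains are images of a common process until a code appears, and from then on the second
chain has the trace law that belongs to the code, then its trace is a splice of the first one with
independent random sequences. -/
theorem traceLaw_eq_splice_of_coupling {J : Type w} {S₁ : Type w₁} {S₂ : Type w₂}
    [MeasurableSpace S₁] [DiscreteMeasurableSpace S₁]
    [MeasurableSpace S₂] [DiscreteMeasurableSpace S₂] {E₁ E₂ C : Type*} [MeasurableSpace E₁]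
    [DiscreteMeasurableSpace E₁] [MeasurableSpace E₂] [Countable C]
    (next₁ : S₁ → PMF S₁) (next₂ : S₂ → PMF S₂) (e₁ : S₁ → E₁) (e₂ : S₂ → E₂)
    (code : E₁ → Option C) (γ : E₁ → E₂) (ν : C → Measure (ℕ → E₂))
    [∀ c, IsProbabilityMeasure (ν c)] (inv : J → Prop) (p : J → PMF J)
    (φ₁ : J → S₁) (φ₂ : J → S₂)
    (hsome : ∀ j c, inv j → code (e₁ (φ₁ j)) = some c → traceLaw next₂ e₂ (φ₂ j) = ν c)
    (hnone : ∀ j, inv j → code (e₁ (φ₁ j)) = none → (∀ j' ∈ (p j).support, inv j') ∧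
      next₁ (φ₁ j) = (p j).map φ₁ ∧ next₂ (φ₂ j) = (p j).map φ₂ ∧ e₂ (φ₂ j) = γ (e₁ (φ₁ j)))
    (j : J) (hj : inv j) :
    traceLaw next₂ e₂ (φ₂ j) = (traceLaw next₁ e₁ (φ₁ j)).bind fun v =>
      (Measure.infinitePi ν).map (splice code γ v) := by
  let _ : MeasurableSpace J := ⊤
  have hg := measurable_splice (E' := E₂) code γ
  have hg₁ : ∀ v, Measurable (splice code γ v : (C → ℕ → E₂) → ℕ → E₂) :=
    fun v => hg.comp measurable_prodMk_left
  let κ : (ℕ → E₁) → Measure (ℕ → E₂) := fun v => (Measure.infinitePi ν).map (splice code γ v)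
  have hκ : Measurable κ := by
    have : κ = fun v => ((Measure.infinitePi ν).map (Prod.mk v)).map
        (Function.uncurry (splice code γ)) := by
      funext v
      rw [Measure.map_map hg measurable_prodMk_left]
      rfl
    rw [this]
    exact (Measure.measurable_map _ hg).comp Measurable.map_prodMk_left
  have : ∀ v, IsProbabilityMeasure (κ v) := fun v =>
    Measure.isProbabilityMeasure_map (hg₁ v).aemeasurable
  have : ∀ j, IsProbabilityMeasure ((traceLaw next₁ e₁ (φ₁ j)).bind κ) := fun j =>
    isProbabilityMeasure_bind _ κ hκ
  refine eq_of_recursion inv p (fun j => traceLaw next₂ e₂ (φ₂ j))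
    (fun j => (traceLaw next₁ e₁ (φ₁ j)).bind κ) (fun j hj => ?_) j hj
  have hp : ∀ j, IsProbabilityMeasure
      ((next₁ (φ₁ j)).toMeasure.bind (traceLaw next₁ e₁)) := fun j =>
    isProbabilityMeasure_bind _ _ .of_discrete
  rcases hc : code (e₁ (φ₁ j)) with _ | c
  · obtain ⟨hinv, h₁, h₂, he⟩ := hnone j hj hc
    refine .inr ⟨e₂ (φ₂ j), hinv, ?_, ?_⟩
    · rw [traceLaw_eq, h₂, ← PMF.toMeasure_map _ _ Measurable.of_discrete,
        bind_map_measure _ .of_discrete .of_discrete]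
    · have hcons : (fun v => κ (consSeq (e₁ (φ₁ j)) v)) =
          fun v => (κ v).map (consSeq (e₂ (φ₂ j))) := by
        funext v
        simp only [κ]
        rw [Measure.map_map (measurable_consSeq _) (hg₁ v), he]
        exact congrArg (Measure.map · _) (funext fun w => splice_consSeq_of_none γ hc v w)
      rw [traceLaw_eq, bind_map_measure _ (measurable_consSeq _) hκ, hcons,
        ← map_bind_measure _ hκ (measurable_consSeq _), h₁,
        ← PMF.toMeasure_map _ _ Measurable.of_discrete,
        bind_map_measure _ .of_discrete .of_discrete,
        Measure.bind_bind Measurable.of_discrete.aemeasurable hκ.aemeasurable]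
  -- At a code the splice forgets `v` and returns the component `w c`, whose marginal law is `ν c`.
  · refine .inl ((hsome j c hj hc).trans ?_)
    have hcons : (fun v => κ (consSeq (e₁ (φ₁ j)) v)) = fun _ => ν c := by
      funext v
      have : splice code γ (consSeq (e₁ (φ₁ j)) v) = fun w : C → ℕ → E₂ => w c :=
        funext fun w => splice_consSeq_of_some γ hc v w
      simp only [κ, this]
      exact Measure.infinitePi_map_eval ν c
    have := hp j
    change ν c = (traceLaw next₁ e₁ (φ₁ j)).bind κ
    rw [traceLaw_eq, bind_map_measure _ (measurable_consSeq _) hκ, hcons, Measure.bind_const,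
      measure_univ, one_smul]

end Splicing

/-! ### Answers and histories -/

section Histories

variable {𝒟 : Type}

/-- Encode an answer; an answer to a privacy-loss query is treated as `invalidQuery`. -/
def encodeAnswer : Answer 𝒟 → Str
  | .empty => []
  | .message m => true :: m
  | .loss _ => [false]
  | .notPrivate => [false, false]
  | .insufficientBudget => [false, false, false]
  | .invalidQuery => [false]
  | .halted => [false, false, false, false]

/-- Decode an answer. -/
def decodeAnswer : Str → Answer 𝒟
  | [] => .empty
  | true :: m => .message m
  | [false] => .invalidQuery
  | [false, _] => .notPrivate
  | [false, _, _] => .insufficientBudget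
  | false :: _ :: _ :: _ :: _ => .halted

/-- Replace an answer to a privacy-loss query by `invalidQuery`. -/
def Answer.censor : Answer 𝒟 → Answer 𝒟
  | .loss _ => .invalidQuery
  | a => a

/-- A reported loss cannot be stored in a binary string for arbitrary `𝒟`, and it need not be: it
can be recomputed from the parameters. -/
theorem decode_encodeAnswer (a : Answer 𝒟) : decodeAnswer (encodeAnswer a) = a.censor := by
  cases a <;> rfl

theorem encodeAnswer_censor (a : Answer 𝒟) : encodeAnswer a.censor = encodeAnswer a := by
  cases a <;> rfl

theorem Answer.censor_censor (a : Answer 𝒟) : a.censor.censor = a.censor := by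
  cases a <;> rfl

/-- The answers that only a filter gives, on and after halting. -/
def Answer.IsStop (a : Answer 𝒟) : Prop := a = .insufficientBudget ∨ a = .halted

theorem Answer.isStop_censor {a : Answer 𝒟} : a.censor.IsStop ↔ a.IsStop := by
  cases a <;> simp [Answer.IsStop, Answer.censor]

/-- The list of parameters after an answer to a query that declares the given parameter, if any. -/
def updateParams : Option 𝒟 → List 𝒟 → Answer 𝒟 → List 𝒟
  | some d, l, .message _ => l ++ [d]
  | _, l, _ => l

theorem updateParams_censor (o : Option 𝒟) (l : List 𝒟) (a : Answer 𝒟) :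
    updateParams o l a.censor = updateParams o l a := by
  cases o <;> cases a <;> rfl

/-- A history: the past coins of the adversary, most recent first, each with the encoding of the
answer on which they were tossed. -/
abbrev History : Type := List (Str × Str)

/-- Encode a history as a binary string. -/
def encodeHistory (h : History) : Str := List.replicate (Encodable.encode h) true

/-- Decode a history. -/
def decodeHistory (c : Str) : History := (Encodable.decode c.length).getD []

@[simp]
theorem decode_encodeHistory (h : History) : decodeHistory (encodeHistory h) = h := by
  simp [decodeHistory, encodeHistory]

/-- The first entry of every view carries empty coins, so the empty string must stand for the empty
history. -/
theorem encodeHistory_nil : encodeHistory [] = [] := by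
  simp [encodeHistory]

/-- The most recent coins of a history. -/
def lastCoins : History → Str
  | [] => []
  | p :: _ => p.1

end Histories

/-! ### Adversaries that reveal their history -/

section Replay

universe u v

variable {𝒟 : Type} {Q : Type u}

/-- What a history determines: the state of the adversary, the parameters used before its pending
query, and this query. -/
structure Replay (T : Type) (𝒟 : Type) (Q : Type u) where
  /-- The state of the adversary. -/
  state : T
  /-- The parameters used before the pending query. -/
  params : List 𝒟
  /-- The pending query. -/
  query : Option Q

variable (𝒜 : Adversary Q (Answer 𝒟)) (param : Q → Option 𝒟)
  (tr : List 𝒟 → Option Q → Answer 𝒟 → Answer 𝒟)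

/-- Reconstruct the run of an adversary that is shown the answers translated by `tr`. -/
def replay : History → Replay 𝒜.State 𝒟 Q
  | [] => ⟨𝒜.start, [], none⟩
  | p :: h =>
    let ρ := replay h
    let b := 𝒜.act ρ.state (tr ρ.params ρ.query (decodeAnswer p.2)) p.1
    ⟨b.1, updateParams (ρ.query.bind param) ρ.params (decodeAnswer p.2), b.2⟩

/-- The answer shown to the adversary. -/
def shown (h : History) (a : Answer 𝒟) : Answer 𝒟 :=
  tr (replay 𝒜 param tr h).params (replay 𝒜 param tr h).query a.censor

open Classical in
/-- The adversary that behaves like `𝒜` on translated answers, but whose coins spell out the whole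
history. When the mechanism has stopped, it goes on with the query `q₀` forever. -/
def replayAdversary (q₀ : Q) : Adversary Q (Answer 𝒟) where
  State := History
  start := []
  coins h a :=
    if a.IsStop then PMF.pure []
    else (𝒜.coins (replay 𝒜 param tr h).state (shown 𝒜 param tr h a)).map fun r =>
      encodeHistory ((r, encodeAnswer a) :: h)
  act _ a c :=
    if a.IsStop then ([], some q₀)
    else (decodeHistory c, (replay 𝒜 param tr (decodeHistory c)).query)

/-- Recover the entry of the view of `𝒜` from the entry of the view of `replayAdversary 𝒜`. -/
def replayEntry : Entry (Answer 𝒟) → Entry (Answer 𝒟)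
  | none => noEntry
  | some (c, none) => endEntry (lastCoins (decodeHistory c))
  | some (_, some .halted) => noEntry
  | some (c, some .insufficientBudget) => endEntry (lastCoins (decodeHistory c))
  | some (c, some a) =>
    msgEntry (lastCoins (decodeHistory c)) (shown 𝒜 param tr (decodeHistory c) a)

theorem replayEntry_msgEntry {a : Answer 𝒟} (ha : ¬ a.IsStop) (h : History) :
    replayEntry 𝒜 param tr (msgEntry (encodeHistory h) a) =
      msgEntry (lastCoins h) (shown 𝒜 param tr h a) := by
  cases a
  case insufficientBudget => exact absurd (.inl rfl) ha
  case halted => exact absurd (.inr rfl) ha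
  all_goals
    exact congrArg (fun k => msgEntry (lastCoins k) (shown 𝒜 param tr k _))
      (decode_encodeHistory h)

theorem replayEntry_endEntry (h : History) :
    replayEntry 𝒜 param tr (endEntry (encodeHistory h)) = endEntry (lastCoins h) :=
  congrArg (fun k => endEntry (lastCoins k)) (decode_encodeHistory h)

theorem replayEntry_insufficientBudget (h : History) :
    replayEntry 𝒜 param tr (msgEntry (encodeHistory h) .insufficientBudget) =
      endEntry (lastCoins h) :=
  congrArg (fun k => endEntry (lastCoins k)) (decode_encodeHistory h)

variable {X : Type} (M : Mechanism.{u, v} X Q (Answer 𝒟)) (cut : M.State → Prop)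

theorem nextStage_replayAdversary (q₀ : Q) (s : M.State) (h : History) {a : Answer 𝒟}
    (ha : ¬ a.IsStop) (e : Entry (Answer 𝒟)) :
    nextStage (replayAdversary 𝒜 param tr q₀) M cut (mkStage (some (s, h, a)) e) =
      (𝒜.coins (replay 𝒜 param tr h).state (shown 𝒜 param tr h a)).bind fun r =>
        respond (replayAdversary 𝒜 param tr q₀) M cut s
          (encodeHistory ((r, encodeAnswer a) :: h)) ((r, encodeAnswer a) :: h)
          (replay 𝒜 param tr ((r, encodeAnswer a) :: h)).query := by
  refine (nextStage_some _ _ _ _ _ _ _).trans ?_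
  simp only [replayAdversary, if_neg ha, PMF.bind_map, Function.comp_def, decode_encodeHistory]

/-- The outer draw is the same toss of the coins of `𝒜` as in `nextStage_replayAdversary`, which
lets the two interactions be coupled toss by toss. -/
theorem nextStage_replay (s : M.State) (h : History) (a : Answer 𝒟) (e : Entry (Answer 𝒟)) :
    nextStage 𝒜 M cut
        (mkStage (some (s, (replay 𝒜 param tr h).state, shown 𝒜 param tr h a)) e) =
      (𝒜.coins (replay 𝒜 param tr h).state (shown 𝒜 param tr h a)).bind fun r =>
        respond 𝒜 M cut s r (replay 𝒜 param tr ((r, encodeAnswer a) :: h)).state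
          (replay 𝒜 param tr ((r, encodeAnswer a) :: h)).query := by
  rw [nextStage_some]
  refine congrArg _ (funext fun r => ?_)
  simp only [replay, decode_encodeAnswer, shown]

theorem nextStage_replayAdversary_halt (q₀ : Q) (s : M.State) (h : History) {a : Answer 𝒟}
    (ha : a.IsStop) (e : Entry (Answer 𝒟)) :
    nextStage (replayAdversary 𝒜 param tr q₀) M cut (mkStage (some (s, h, a)) e) =
      respond (replayAdversary 𝒜 param tr q₀) M cut s [] [] (some q₀) := by
  refine (nextStage_some _ _ _ _ _ _ _).trans ?_
  simp only [replayAdversary, if_pos ha, PMF.pure_bind]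

end Replay

/-! ### Filters that run an odometer -/

theorem pure_map_eq {α β : Type*} (f : α → β) (a : α) (b : β) (h : b = f a) :
    PMF.pure b = (PMF.pure a).map f := by
  rw [PMF.pure_map, h]

theorem map_congr_support {α β : Type*} (p : PMF α) {f g : α → β}
    (h : ∀ a ∈ p.support, f a = g a) : p.map f = p.map g := by
  rw [← PMF.bind_pure_comp, ← PMF.bind_pure_comp]
  ext b
  simp only [PMF.bind_apply, Function.comp_apply]
  refine tsum_congr fun a => ?_
  by_cases ha : p a = 0
  · simp [ha]
  · rw [h a ((p.mem_support_iff a).2 ha)]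

universe u v v'

variable {𝒟 : Type} [PartialOrder 𝒟] {X : Type} {Q : Type u}

open Classical in
/-- `F` runs the odometer `O` as long as the privacy loss `G` of the declared parameters stays
below `d`. -/
structure RunsUpTo (G : List 𝒟 → 𝒟) (d : 𝒟) (O : Odometer.{u, v} 𝒟 X Q (Answer 𝒟))
    (F : Mechanism.{u, v'} X Q (Answer 𝒟)) where
  /-- The initial state of the odometer. -/
  start : X → O.State
  /-- The parameters used so far. -/
  params : O.State → List 𝒟
  /-- The state of the filter that runs the odometer in a given state. -/
  run : O.State → F.State
  /-- The state of the filter after halting. -/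
  haltState : F.State
  /-- The parameter declared in a query. -/
  param : Q → Option 𝒟
  init_odometer : ∀ x, O.init x = PMF.pure (start x, .empty)
  init_filter : ∀ x, F.init x = PMF.pure (run (start x), .empty)
  params_start : ∀ x, params (start x) = []
  loss_eq : ∀ s, O.loss s = G (params s)
  step_halt : ∀ q, F.step haltState q = PMF.pure (haltState, .halted)
  step_run : ∀ s q, G (params s) ≤ d → F.step (run s) q = (O.step s q).map fun p =>
    if G (params p.1) ≤ d then (run p.1, p.2.censor) else (haltState, .insufficientBudget)
  not_isStop : ∀ s q, ∀ p ∈ (O.step s q).support, ¬ p.2.IsStop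
  params_step : ∀ s q, ∀ p ∈ (O.step s q).support,
    params p.1 = updateParams (param q) (params s) p.2
  step_loss : ∀ s, ∀ p ∈ (O.step s O.lossQuery).support, p.2 = .loss (G (params s))
  censor_step : ∀ s q, q ≠ O.lossQuery → ∀ p ∈ (O.step s q).support, p.2.censor = p.2

/-- The common states of a simulated interaction with an odometer and with a filter. -/
inductive Sim (S : Type v) (𝒟 : Type) : Type v
  /-- Both interactions go on after the answer `a`. -/
  | live (s : S) (h : History) (a : Answer 𝒟)
  /-- The budget has just been exceeded. -/
  | cutoff (h : History)
  /-- The filter has halted. -/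
  | stopped
  /-- The adversary has just halted. -/
  | finished (h : History)
  /-- Both interactions are over. -/
  | over

namespace RunsUpTo

variable {G : List 𝒟 → 𝒟} {d : 𝒟} {O : Odometer.{u, v} 𝒟 X Q (Answer 𝒟)}
  {F : Mechanism.{u, v'} X Q (Answer 𝒟)} (R : RunsUpTo G d O F)
  (𝒜 : Adversary Q (Answer 𝒟)) (tr : List 𝒟 → Option Q → Answer 𝒟 → Answer 𝒟)

open Classical in
/-- The step of the simulation, given the pending query. -/
def simRespond (s : O.State) (h : History) : Option Q → PMF (Sim O.State 𝒟)
  | none => PMF.pure (.finished h)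
  | some q => (O.step s q).map fun p =>
      if G (R.params p.1) ≤ d then .live p.1 h p.2 else .cutoff h

/-- The step of the simulation. -/
def simNext : Sim O.State 𝒟 → PMF (Sim O.State 𝒟)
  | .live s h a => (𝒜.coins (replay 𝒜 R.param tr h).state (shown 𝒜 R.param tr h a)).bind fun r =>
      R.simRespond s ((r, encodeAnswer a) :: h)
        (replay 𝒜 R.param tr ((r, encodeAnswer a) :: h)).query
  | .cutoff _ => PMF.pure .stopped
  | .stopped => PMF.pure .stopped
  | .finished _ => PMF.pure .over
  | .over => PMF.pure .over

theorem simNext_support {inv : Sim O.State 𝒟 → Prop} {s : O.State} {h : History} {a : Answer 𝒟}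
    (hfin : ∀ h', (replay 𝒜 R.param tr h').query = none → inv (.finished h'))
    (hlive : ∀ r q, (replay 𝒜 R.param tr ((r, encodeAnswer a) :: h)).query = some q →
      ∀ p ∈ (O.step s q).support, G (R.params p.1) ≤ d →
        inv (.live p.1 ((r, encodeAnswer a) :: h) p.2))
    (hcut : ∀ h', (replay 𝒜 R.param tr h').query ≠ none → inv (.cutoff h'))
    {j : Sim O.State 𝒟} (hj : j ∈ (R.simNext 𝒜 tr (.live s h a)).support) : inv j := by
  rw [simNext, PMF.mem_support_bind_iff] at hj
  obtain ⟨r, -, hj⟩ := hj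
  rcases hq : (replay 𝒜 R.param tr ((r, encodeAnswer a) :: h)).query with _ | q
  · rw [hq, simRespond, PMF.mem_support_pure_iff] at hj
    exact hj ▸ hfin _ hq
  · rw [hq, simRespond, PMF.mem_support_map_iff] at hj
    obtain ⟨p, hp, rfl⟩ := hj
    by_cases hd : G (R.params p.1) ≤ d
    · rw [if_pos hd]
      exact hlive r q hq p hp hd
    · rw [if_neg hd]
      exact hcut _ (by simp [hq])

/-! #### A filter simulates an odometer -/

/-- The stage of the interaction of `replayAdversary 𝒜` with the filter. -/
def filterStage : Sim O.State 𝒟 → Stage F.State History (Answer 𝒟)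
  | .live s h a => mkStage (some (R.run s, h, a.censor)) (msgEntry (encodeHistory h) a.censor)
  | .cutoff h => mkStage (some (R.haltState, h, .insufficientBudget))
      (msgEntry (encodeHistory h) .insufficientBudget)
  | .stopped => mkStage (some (R.haltState, [], .halted)) (msgEntry [] .halted)
  | .finished h => mkStage none (endEntry (encodeHistory h))
  | .over => mkStage none noEntry

/-- The stage of the interaction of `𝒜` with the odometer. -/
def odometerStage : Sim O.State 𝒟 → Stage O.State 𝒜.State (Answer 𝒟)
  | .live s h a => mkStage (some (s, (replay 𝒜 R.param tr h).state, a)) (msgEntry (lastCoins h) a)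
  | .cutoff h => mkStage none (endEntry (lastCoins h))
  | .stopped => mkStage none noEntry
  | .finished h => mkStage none (endEntry (lastCoins h))
  | .over => mkStage none noEntry

theorem nextStage_halt (q₀ : Q) (h : History) {a : Answer 𝒟} (ha : a.IsStop)
    (e : Entry (Answer 𝒟)) :
    nextStage (replayAdversary 𝒜 R.param tr q₀) F (fun _ => False)
      (mkStage (some (R.haltState, h, a)) e) =
      (PMF.pure (Sim.stopped (S := O.State) (𝒟 := 𝒟))).map R.filterStage := by
  refine (nextStage_replayAdversary_halt 𝒜 R.param tr F _ q₀ R.haltState h ha e).trans ?_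
  simp only [respond, R.step_halt, PMF.pure_map]
  exact congrArg PMF.pure (deliver_of_not_cut not_false _ _ _)

theorem nextStage_filterStage (q₀ : Q) {s : O.State} {h : History} {a : Answer 𝒟}
    (ha : ¬ a.IsStop) (hs : G (R.params s) ≤ d) :
    nextStage (replayAdversary 𝒜 R.param tr q₀) F (fun _ => False)
      (R.filterStage (.live s h a)) = (R.simNext 𝒜 tr (.live s h a)).map R.filterStage := by
  refine (nextStage_replayAdversary 𝒜 R.param tr F _ q₀ (R.run s) h
    (mt Answer.isStop_censor.1 ha) _).trans ?_
  rw [simNext, PMF.map_bind]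
  simp only [encodeAnswer_censor, shown, Answer.censor_censor]
  refine congrArg _ (funext fun r => ?_)
  rcases (replay 𝒜 R.param tr ((r, encodeAnswer a) :: h)).query with _ | q
  · exact pure_map_eq _ _ _ rfl
  · simp only [respond, simRespond, R.step_run s q hs, PMF.map_comp]
    refine congrArg (PMF.map · _) (funext fun p => ?_)
    simp only [Function.comp_apply]
    split_ifs with hd
    · exact deliver_of_not_cut not_false _ _ _
    · exact deliver_of_not_cut not_false _ _ _

/-- The hypothesis `ha` says that the restored answer is the true one, so that `𝒜` and its
simulation toss coins with the same law. -/
theorem nextStage_odometerStage {s : O.State} {h : History} {a : Answer 𝒟}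
    (ha : shown 𝒜 R.param tr h a = a) :
    nextStage 𝒜 O.toMechanism (fun s => ¬ O.loss s ≤ d) (R.odometerStage 𝒜 tr (.live s h a)) =
      (R.simNext 𝒜 tr (.live s h a)).map (R.odometerStage 𝒜 tr) := by
  have key := nextStage_replay 𝒜 R.param tr O.toMechanism (fun s => ¬ O.loss s ≤ d) s h a
    (msgEntry (lastCoins h) a)
  rw [ha] at key
  refine key.trans ?_
  rw [simNext, PMF.map_bind, ha]
  refine congrArg _ (funext fun r => ?_)
  rcases (replay 𝒜 R.param tr ((r, encodeAnswer a) :: h)).query with _ | q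
  · exact pure_map_eq _ _ _ rfl
  · simp only [respond, simRespond, PMF.map_comp]
    refine congrArg (PMF.map · _) (funext fun p => ?_)
    simp only [Function.comp_apply]
    split_ifs with hd
    · exact deliver_of_not_cut (cut := fun s => ¬ O.loss s ≤ d)
        (not_not.2 ((R.loss_eq p.1).trans_le hd)) _ _ _
    · exact deliver_of_cut (fun h => hd ((R.loss_eq p.1).symm.trans_le h)) _ _ _

open Classical in
/-- Restore the answers to privacy-loss queries. -/
def restoreLoss (G : List 𝒟 → 𝒟) (lossQuery : Q) (l : List 𝒟) (q : Option Q) (a : Answer 𝒟) :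
    Answer 𝒟 :=
  if q = some lossQuery then .loss (G l) else a

/-- Both interactions are images of `Sim`. After a refusal the simulating adversary keeps asking, so
each later entry carries `halted` and is mapped to `noEntry`; had it halted instead, its final entry
would be indistinguishable in form from a genuine end of the view. -/
theorem truncatedView_eq_map (hG : G [] ≤ d) (x : X) :
    (truncatedView d 𝒜 O x : Measure (View (Answer 𝒟))) =
      (view (replayAdversary 𝒜 R.param (restoreLoss G O.lossQuery) O.lossQuery) F x :
        Measure (View (Answer 𝒟))).map
      fun v n => replayEntry 𝒜 R.param (restoreLoss G O.lossQuery) (v n) := by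
  -- In the invariant below, the history determines the parameters of the odometer; this is what
  -- makes the restored answer to a privacy-loss query correct.
  let tr : List 𝒟 → Option Q → Answer 𝒟 → Answer 𝒟 := restoreLoss G O.lossQuery
  let inv : Sim O.State 𝒟 → Prop
    | .live s h a => ¬ a.IsStop ∧ G (R.params s) ≤ d ∧ shown 𝒜 R.param tr h a = a ∧
        R.params s = updateParams ((replay 𝒜 R.param tr h).query.bind R.param)
          (replay 𝒜 R.param tr h).params a
    | _ => True
  have hinv : ∀ j, inv j → ∀ j' ∈ (R.simNext 𝒜 tr j).support, inv j' := by
    rintro (⟨s, h, a⟩ | h | _ | h | _) hj j' hj'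
    · obtain ⟨-, -, -, hp⟩ := hj
      refine R.simNext_support 𝒜 tr (inv := inv) (fun _ _ => trivial) (fun r q hq p hps hd => ?_)
        (fun _ _ => trivial) hj'
      have hpar : (replay 𝒜 R.param tr ((r, encodeAnswer a) :: h)).params = R.params s := by
        rw [hp]
        simp only [replay, decode_encodeAnswer, updateParams_censor]
      refine ⟨R.not_isStop s q p hps, hd, ?_, ?_⟩
      · rw [shown, hpar, hq]
        by_cases hl : q = O.lossQuery
        · subst hl
          rw [R.step_loss s p hps]
          exact if_pos rfl
        · rw [R.censor_step s q hl p hps]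
          exact if_neg fun h => hl (Option.some.inj h)
      · rw [hpar, hq]
        exact R.params_step s q p hps
    all_goals
      rw [simNext, PMF.mem_support_pure_iff] at hj'
      subst hj'
      trivial
  have key := traceLaw_eq_map_of_coupling
    (nextStage (replayAdversary 𝒜 R.param tr O.lossQuery) F fun _ => False)
    (nextStage 𝒜 O.toMechanism fun s => ¬ O.loss s ≤ d)
    (fun z => (z.2 : Entry (Answer 𝒟))) (fun z => (z.2 : Entry (Answer 𝒟)))
    (replayEntry 𝒜 R.param tr) (fun _ _ => trivial) inv (R.simNext 𝒜 tr) R.filterStage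
    (R.odometerStage 𝒜 tr) hinv ?_ ?_ ?_ (.live (R.start x) [] .empty)
    ⟨by simp [Answer.IsStop], by rwa [R.params_start],
      by simp [shown, tr, restoreLoss, replay, Answer.censor], R.params_start x⟩
  · refine Eq.trans ?_ (key.trans (congrArg (Measure.map _) ?_))
    · refine (coe_stoppedView_of_init_eq_pure 𝒜 O.toMechanism _ x (R.init_odometer x)).trans ?_
      refine congrArg _ (deliver_of_not_cut (cut := fun s => ¬ O.loss s ≤ d) (not_not.2 ?_) _ _ _)
      rwa [R.loss_eq, R.params_start]
    · refine Eq.trans ?_ (coe_stoppedView_of_init_eq_pure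
        (replayAdversary 𝒜 R.param tr O.lossQuery) F _ x (R.init_filter x)).symm
      refine congrArg _ (Eq.trans ?_ (deliver_of_not_cut not_false _ _ _).symm)
      rw [filterStage, encodeHistory_nil]
      rfl
  · rintro (⟨s, h, a⟩ | h | _ | h | _) hj
    · exact R.nextStage_filterStage 𝒜 tr O.lossQuery hj.1 hj.2.1
    · exact R.nextStage_halt 𝒜 tr O.lossQuery h (.inl rfl) _
    · exact R.nextStage_halt 𝒜 tr O.lossQuery [] (.inr rfl) _
    · exact pure_map_eq _ _ _ rfl
    · exact pure_map_eq _ _ _ rfl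
  · rintro (⟨s, h, a⟩ | h | _ | h | _) hj
    · exact R.nextStage_odometerStage 𝒜 tr hj.2.2.1
    all_goals exact pure_map_eq _ _ _ rfl
  · rintro (⟨s, h, a⟩ | h | _ | h | _) hj
    · refine Eq.trans ?_
        (replayEntry_msgEntry 𝒜 R.param tr (mt Answer.isStop_censor.1 hj.1) h).symm
      rw [shown, Answer.censor_censor]
      exact congrArg (msgEntry _) hj.2.2.1.symm
    · exact (replayEntry_insufficientBudget 𝒜 R.param tr h).symm
    · rfl
    · exact (replayEntry_endEntry 𝒜 R.param tr h).symm
    · rfl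

/-! #### An odometer simulates a filter -/

/-- The translation of answers in the simulation of a filter. -/
def keepAnswer (_ : List 𝒟) (_ : Option Q) (a : Answer 𝒟) : Answer 𝒟 := a

/-- The stage of the interaction of `replayAdversary 𝒜` with the odometer. -/
def odometerStage' : Sim O.State 𝒟 → Stage O.State History (Answer 𝒟)
  | .live s h a => mkStage (some (s, h, a)) (msgEntry (encodeHistory h) a)
  | .cutoff h => mkStage none (endEntry (encodeHistory h))
  | .stopped => mkStage none noEntry
  | .finished h => mkStage none (endEntry (encodeHistory h))
  | .over => mkStage none noEntry

/-- The stage of the interaction of `𝒜` with the filter. -/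
def filterStage' : Sim O.State 𝒟 → Stage F.State 𝒜.State (Answer 𝒟)
  | .live s h a => mkStage (some (R.run s, (replay 𝒜 R.param keepAnswer h).state, a.censor))
      (msgEntry (lastCoins h) a.censor)
  | .cutoff h => mkStage
      (some (R.haltState, (replay 𝒜 R.param keepAnswer h).state, .insufficientBudget))
      (msgEntry (lastCoins h) .insufficientBudget)
  | .stopped => mkStage none noEntry
  | .finished h => mkStage none (endEntry (lastCoins h))
  | .over => mkStage none noEntry

theorem nextStage_odometerStage' (q₀ : Q) {s : O.State} {h : History} {a : Answer 𝒟}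
    (ha : ¬ a.IsStop) :
    nextStage (replayAdversary 𝒜 R.param tr q₀) O.toMechanism (fun s => ¬ O.loss s ≤ d)
      (odometerStage' (.live s h a)) = (R.simNext 𝒜 tr (.live s h a)).map odometerStage' := by
  refine (nextStage_replayAdversary 𝒜 R.param tr O.toMechanism _ q₀ s h ha _).trans ?_
  rw [simNext, PMF.map_bind]
  refine congrArg _ (funext fun r => ?_)
  rcases (replay 𝒜 R.param tr ((r, encodeAnswer a) :: h)).query with _ | q
  · exact pure_map_eq _ _ _ rfl
  · simp only [respond, simRespond, PMF.map_comp]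
    refine congrArg (PMF.map · _) (funext fun p => ?_)
    simp only [Function.comp_apply]
    split_ifs with hd
    · exact deliver_of_not_cut (cut := fun s => ¬ O.loss s ≤ d)
        (not_not.2 ((R.loss_eq p.1).trans_le hd)) _ _ _
    · exact deliver_of_cut (fun h => hd ((R.loss_eq p.1).symm.trans_le h)) _ _ _

theorem nextStage_filterStage' {s : O.State} {h : History} {a : Answer 𝒟}
    (hs : G (R.params s) ≤ d) :
    nextStage 𝒜 F (fun _ => False) (R.filterStage' 𝒜 (.live s h a)) =
      (R.simNext 𝒜 keepAnswer (.live s h a)).map (R.filterStage' 𝒜) := by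
  refine (nextStage_replay 𝒜 R.param keepAnswer F (fun _ => False) (R.run s) h a _).trans ?_
  rw [simNext, PMF.map_bind]
  refine congrArg _ (funext fun r => ?_)
  rcases (replay 𝒜 R.param keepAnswer ((r, encodeAnswer a) :: h)).query with _ | q
  · exact pure_map_eq _ _ _ rfl
  · simp only [respond, simRespond, R.step_run s q hs, PMF.map_comp]
    refine congrArg (PMF.map · _) (funext fun p => ?_)
    simp only [Function.comp_apply]
    split_ifs with hd
    · exact deliver_of_not_cut not_false _ _ _
    · exact deliver_of_not_cut not_false _ _ _

/-- The coins after which the interaction with the odometer was cut off, if the entry ends the view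
although a query is pending. -/
def cutoffCode : Entry (Answer 𝒟) → Option Str
  | some (c, none) =>
    if (replay 𝒜 R.param keepAnswer (decodeHistory c)).query.isSome then some c else none
  | _ => none

theorem cutoffCode_endEntry (h : History) :
    R.cutoffCode 𝒜 (endEntry (encodeHistory h)) =
      if (replay 𝒜 R.param keepAnswer h).query.isSome then some (encodeHistory h) else none :=
  congrArg (fun k => if (replay 𝒜 R.param keepAnswer k).query.isSome then
    some (encodeHistory h) else none) (decode_encodeHistory h)

/-- The law of the entries of the view of `𝒜` from the moment the filter has halted. -/
def afterCutoff (c : Str) : Measure (View (Answer 𝒟)) :=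
  entriesFrom 𝒜 F (fun _ => False) (R.filterStage' 𝒜 (.cutoff (decodeHistory c)))

instance instIsProbabilityMeasureAfterCutoff (c : Str) :
    IsProbabilityMeasure (R.afterCutoff 𝒜 c) := by
  unfold afterCutoff
  infer_instance

instance instDiscreteMeasurableSpaceEntry (A : Type) : DiscreteMeasurableSpace (Entry A) :=
  ⟨fun _ => trivial⟩

/-- A view that ends with a query pending was cut off by the budget; one that ends without a query
was ended by `𝒜`. Only the first kind needs a tail, and the coins at the cut determine the state of
`𝒜` and hence the law of that tail. -/
theorem view_eq_bind_splice (hG : G [] ≤ d) (x : X) :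
    (view 𝒜 F x : Measure (View (Answer 𝒟))) =
      (truncatedView d (replayAdversary 𝒜 R.param keepAnswer O.lossQuery) O x :
        Measure (View (Answer 𝒟))).bind fun v => (Measure.infinitePi (R.afterCutoff 𝒜)).map
          (splice (R.cutoffCode 𝒜) (replayEntry 𝒜 R.param keepAnswer) v) := by
  -- `stopped` can be excluded: `cutoff` carries a code, at which the coupling gives way to the tail
  -- law and is not continued.
  let inv : Sim O.State 𝒟 → Prop
    | .live s _ a => ¬ a.IsStop ∧ G (R.params s) ≤ d
    | .cutoff h => (replay 𝒜 R.param keepAnswer h).query ≠ none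
    | .stopped => False
    | .finished h => (replay 𝒜 R.param keepAnswer h).query = none
    | .over => True
  have key := traceLaw_eq_splice_of_coupling
    (nextStage (replayAdversary 𝒜 R.param keepAnswer O.lossQuery) O.toMechanism
      fun s => ¬ O.loss s ≤ d)
    (nextStage 𝒜 F fun _ => False)
    (fun z => (z.2 : Entry (Answer 𝒟))) (fun z => (z.2 : Entry (Answer 𝒟)))
    (R.cutoffCode 𝒜) (replayEntry 𝒜 R.param keepAnswer) (R.afterCutoff 𝒜) inv
    (R.simNext 𝒜 keepAnswer) odometerStage' (R.filterStage' 𝒜) ?_ ?_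
    (.live (R.start x) [] .empty)
    ⟨by simp [Answer.IsStop], by rwa [R.params_start]⟩
  · refine Eq.trans ?_ (key.trans (congrArg (Measure.bind · _) ?_))
    · refine (coe_stoppedView_of_init_eq_pure 𝒜 F _ x (R.init_filter x)).trans ?_
      exact congrArg _ (deliver_of_not_cut not_false _ _ _)
    · refine Eq.trans ?_ (coe_stoppedView_of_init_eq_pure
        (replayAdversary 𝒜 R.param keepAnswer O.lossQuery) O.toMechanism _ x
        (R.init_odometer x)).symm
      refine congrArg _ (Eq.trans ?_ (deliver_of_not_cut (cut := fun s => ¬ O.loss s ≤ d)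
        (not_not.2 ?_) _ _ _).symm)
      · rw [odometerStage', encodeHistory_nil]
        rfl
      · rwa [R.loss_eq, R.params_start]
  · rintro (⟨s, h, a⟩ | h | _ | h | _) c hj hc
    · cases hc
    · have := (R.cutoffCode_endEntry 𝒜 h).symm.trans hc
      rw [if_pos (Option.isSome_iff_ne_none.2 hj)] at this
      obtain rfl := Option.some.inj this
      rw [afterCutoff, decode_encodeHistory]
    · exact hj.elim
    · have := (R.cutoffCode_endEntry 𝒜 h).symm.trans hc
      rw [show (replay 𝒜 R.param keepAnswer h).query = none from hj] at this
      cases this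
    · cases hc
  · rintro (⟨s, h, a⟩ | h | _ | h | _) hj hc
    · refine ⟨fun j' hj' => R.simNext_support 𝒜 keepAnswer (inv := inv) (fun _ h => h)
        (fun r q _ p hps hd => ⟨R.not_isStop s q p hps, hd⟩) (fun _ h => h) hj',
        R.nextStage_odometerStage' 𝒜 keepAnswer O.lossQuery hj.1,
        R.nextStage_filterStage' 𝒜 hj.2, ?_⟩
      exact (replayEntry_msgEntry 𝒜 R.param keepAnswer hj.1 h).symm
    · have := (R.cutoffCode_endEntry 𝒜 h).symm.trans hc
      rw [if_pos (Option.isSome_iff_ne_none.2 hj)] at this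
      cases this
    · exact hj.elim
    · refine ⟨fun j' hj' => ?_, pure_map_eq _ _ _ rfl, pure_map_eq _ _ _ rfl,
        (replayEntry_endEntry 𝒜 R.param keepAnswer h).symm⟩
      rw [simNext, PMF.mem_support_pure_iff] at hj'
      subst hj'
      trivial
    · refine ⟨fun j' hj' => ?_, pure_map_eq _ _ _ rfl, pure_map_eq _ _ _ rfl, rfl⟩
      rw [simNext, PMF.mem_support_pure_iff] at hj'
      subst hj'
      trivial

/-! #### Transfer of privacy -/

variable (D : GeneralizedDistance 𝒟) {x x' : X}

theorem dist_truncatedView_le (R : RunsUpTo G d O F)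
    (hF : ∀ 𝒜 : Adversary Q (Answer 𝒟), D.dist (view 𝒜 F x) (view 𝒜 F x') ≤ d) :
    D.dist (truncatedView d 𝒜 O x) (truncatedView d 𝒜 O x') ≤ d := by
  by_cases hG : G [] ≤ d
  · let g : View (Answer 𝒟) → View (Answer 𝒟) := fun v n =>
      replayEntry 𝒜 R.param (restoreLoss G O.lossQuery) (v n)
    have hg : Measurable g := measurable_pi_lambda _ fun n =>
      (Measurable.of_discrete (f := replayEntry 𝒜 R.param (restoreLoss G O.lossQuery))).comp
        (measurable_pi_apply n)
    let ℬ := replayAdversary 𝒜 R.param (restoreLoss G O.lossQuery) O.lossQuery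
    have key : ∀ x, truncatedView d 𝒜 O x = (view ℬ F x).map hg.aemeasurable :=
      fun x => Subtype.ext (R.truncatedView_eq_map 𝒜 hG x)
    rw [key, key]
    exact (D.postprocessing g hg _ _).trans (hF ℬ)
  -- The initial loss already exceeds the budget, so even the first message is withheld and the
  -- dataset plays no role.
  · have key : ∀ x, (truncatedView d 𝒜 O x : Measure (View (Answer 𝒟))) =
        entriesFrom 𝒜 O.toMechanism (fun s => ¬ O.loss s ≤ d) (mkStage none (endEntry [])) := by
      intro x
      refine (coe_stoppedView_of_init_eq_pure 𝒜 O.toMechanism _ x (R.init_odometer x)).trans ?_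
      refine congrArg _ (deliver_of_cut (cut := fun s => ¬ O.loss s ≤ d) ?_ _ _ _)
      rwa [R.loss_eq, R.params_start]
    rw [show truncatedView d 𝒜 O x = truncatedView d 𝒜 O x' from
      Subtype.ext ((key x).trans (key x').symm)]
    exact D.dist_self_le (hF 𝒜) _

/-- When `G [] ≤ d` fails, the truncated view carries no information, so `hO` alone cannot control
the filter. The condition `hinit` says that the filter then never leaves its initial state except to
halt, with answers that do not depend on the dataset. -/
theorem dist_view_le (R : RunsUpTo G d O F)
    (hO : ∀ 𝒜 : Adversary Q (Answer 𝒟),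
      D.dist (truncatedView d 𝒜 O x) (truncatedView d 𝒜 O x') ≤ d)
    (hinit : ¬ G [] ≤ d → ∃ c : Q → Bool × Answer 𝒟, ∀ x q, F.step (R.run (R.start x)) q =
      PMF.pure (if (c q).1 then R.haltState else R.run (R.start x), (c q).2)) :
    D.dist (view 𝒜 F x) (view 𝒜 F x') ≤ d := by
  by_cases hG : G [] ≤ d
  · exact (D.postprocessing_seed (splice (R.cutoffCode 𝒜) (replayEntry 𝒜 R.param keepAnswer))
      (measurable_splice _ _) (Measure.infinitePi (R.afterCutoff 𝒜)) _ _ _ _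
      (R.view_eq_bind_splice 𝒜 hG x) (R.view_eq_bind_splice 𝒜 hG x')).trans (hO _)
  · obtain ⟨c, hc⟩ := hinit hG
    -- A two-state machine without a dataset that reproduces the filter; the state `true` means
    -- halted.
    let N : Mechanism.{u, 0} Unit Q (Answer 𝒟) :=
      { State := Bool
        init := fun _ => PMF.pure (false, .empty)
        step := fun b q => PMF.pure (if b then (true, .halted) else c q) }
    have key : ∀ x, view 𝒜 F x = view 𝒜 N () := by
      intro x
      refine view_eq_of_semiconj 𝒜 F N
        (fun b : Bool => if b then R.haltState else R.run (R.start x)) x () ?_ ?_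
      · rw [R.init_filter]
        exact pure_map_eq _ _ _ rfl
      · rintro (_ | _) q
        · exact (hc x q).trans (pure_map_eq _ _ _ rfl)
        · exact (R.step_halt q).trans (pure_map_eq _ _ _ rfl)
    rw [key, key]
    exact D.dist_self_le (hO 𝒜) _

end RunsUpTo

/-! ### Parameters and answers in concurrent compositions -/

section Launched

variable {𝒟 X : Type}

theorem launchIM_support {x : X} {l : List (Launched 𝒟 X)} {M : IM X} {d' : 𝒟} {p}
    (hp : p ∈ (launchIM x l M d').support) :
    p.1.2.map Launched.param = l.map Launched.param ++ [d'] ∧ ∃ m, p.2 = .message m := by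
  rw [launchIM, PMF.mem_support_map_iff] at hp
  obtain ⟨y, -, rfl⟩ := hp
  exact ⟨by simp, _, rfl⟩

/-- An answered query changes only the state of one launched mechanism, so it consumes no budget. -/
theorem askIM_support {x : X} {l : List (Launched 𝒟 X)} {j : ℕ} {q : Str} {p}
    (hp : p ∈ (askIM x l j q).support) :
    p.1.2.map Launched.param = l.map Launched.param ∧
      ((∃ m, p.2 = .message m) ∨ p.2 = .invalidQuery) := by
  rcases hc : l[j]? with _ | c
  · rw [askIM, hc] at hp
    obtain rfl := (PMF.mem_support_pure_iff _ _).1 hp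
    exact ⟨rfl, .inr rfl⟩
  · rw [askIM, hc] at hp
    obtain ⟨y, -, rfl⟩ := (PMF.mem_support_map_iff _ _ _).1 hp
    refine ⟨?_, .inl ⟨_, rfl⟩⟩
    rw [List.map_set]
    obtain ⟨hj, hc⟩ := List.getElem?_eq_some_iff.1 hc
    refine List.ext_getElem (by simp) fun i h₁ h₂ => ?_
    rw [List.getElem_set]
    split_ifs with hi
    · subst hi
      simp [hc]
    · rfl

end Launched

section Compositions

variable {𝒟 : Type} [PartialOrder 𝒟] (D : GeneralizedDistance 𝒟) {X : Type} (adj : X → X → Prop)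
  (G : List 𝒟 → 𝒟) (d : 𝒟)

theorem ruleOf_eq_true {l : List 𝒟} {d : 𝒟} : ruleOf G l d = true ↔ G l ≤ d := by
  simp [ruleOf]

/-! ### The noninteractive setting -/

/-- The privacy parameter declared in a query. -/
def NIMQuery.param : NIMQuery 𝒟 X → Option 𝒟
  | .launch _ d => some d
  | _ => none

theorem odomNIM_step_launch_pos {M : X → PMF Str} {d' : 𝒟} (h : IsNoninteractiveDP D adj d' M)
    (x : X) (l : List 𝒟) :
    (odomNIM D adj G).step (x, l) (.launch M d') =
      (M x).map fun m => ((x, l ++ [d']), .message m) := if_pos h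

theorem odomNIM_step_launch_neg {M : X → PMF Str} {d' : 𝒟} (h : ¬ IsNoninteractiveDP D adj d' M)
    (x : X) (l : List 𝒟) :
    (odomNIM D adj G).step (x, l) (.launch M d') = PMF.pure ((x, l), .notPrivate) := if_neg h

theorem odomNIM_step_support (x : X) (l : List 𝒟) (q : NIMQuery 𝒟 X) (p)
    (hp : p ∈ ((odomNIM D adj G).step (x, l) q).support) :
    ¬ p.2.IsStop ∧ p.1.2 = updateParams q.param l p.2 ∧ (q = .privacyLoss → p.2 = .loss (G l)) ∧
      (q ≠ .privacyLoss → p.2.censor = p.2) := by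
  cases q with
  | launch M d' =>
    by_cases hM : IsNoninteractiveDP D adj d' M
    · rw [odomNIM_step_launch_pos D adj G hM] at hp
      obtain ⟨m, -, rfl⟩ := (PMF.mem_support_map_iff _ _ _).1 hp
      exact ⟨by simp [Answer.IsStop], rfl, nofun, fun _ => rfl⟩
    · rw [odomNIM_step_launch_neg D adj G hM] at hp
      obtain rfl := (PMF.mem_support_pure_iff _ _).1 hp
      exact ⟨by simp [Answer.IsStop], rfl, nofun, fun _ => rfl⟩
  | privacyLoss =>
    obtain rfl := (PMF.mem_support_pure_iff _ _).1 hp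
    exact ⟨by simp [Answer.IsStop], rfl, fun _ => rfl, fun h => (h rfl).elim⟩
  | other m =>
    obtain rfl := (PMF.mem_support_pure_iff _ _).1 hp
    exact ⟨by simp [Answer.IsStop], rfl, nofun, fun _ => rfl⟩

/-- `Filt(NIM)` runs `Odom(NIM)`. -/
def runsUpToNIM : RunsUpTo G d (odomNIM D adj G) (filtNIM D adj (ruleOf G) d) where
  start x := (x, [])
  params s := s.2
  run s := some s
  haltState := none
  param := NIMQuery.param
  init_odometer _ := rfl
  init_filter _ := rfl
  params_start _ := rfl
  loss_eq _ := rfl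
  step_halt _ := rfl
  step_run := by
    rintro ⟨x, l⟩ (⟨M, d'⟩ | _ | m) hl
    · by_cases hM : IsNoninteractiveDP D adj d' M
      · by_cases hd : G (l ++ [d']) ≤ d
        · refine ((if_pos hM).trans (if_pos ((ruleOf_eq_true G).2 hd))).trans (Eq.symm ?_)
          refine (congrArg (PMF.map _) (odomNIM_step_launch_pos D adj G hM x l)).trans ?_
          exact (PMF.map_comp _ _ _).trans (congrArg (PMF.map · _) (funext fun _ => if_pos hd))
        · refine ((if_pos hM).trans (if_neg (mt (ruleOf_eq_true G).1 hd))).trans (Eq.symm ?_)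
          refine (congrArg (PMF.map _) (odomNIM_step_launch_pos D adj G hM x l)).trans ?_
          -- The odometer runs `M` although the filter refuses it; the output is discarded, which
          -- leaves a constant law.
          refine (PMF.map_comp _ _ _).trans
            (Eq.trans (congrArg (PMF.map · _) (funext fun _ => if_neg hd)) (PMF.map_const _ _))
      · refine (if_neg hM).trans (Eq.symm ?_)
        refine (congrArg (PMF.map _) (odomNIM_step_launch_neg D adj G hM x l)).trans ?_
        exact (PMF.pure_map _ _).trans (congrArg PMF.pure (if_pos hl))
    · exact pure_map_eq _ _ _ (if_pos hl).symm
    · exact pure_map_eq _ _ _ (if_pos hl).symm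
  not_isStop s q p hp := (odomNIM_step_support D adj G s.1 s.2 q p hp).1
  params_step s q p hp := (odomNIM_step_support D adj G s.1 s.2 q p hp).2.1
  step_loss s p hp := (odomNIM_step_support D adj G s.1 s.2 _ p hp).2.2.1 rfl
  censor_step s q hq p hp := (odomNIM_step_support D adj G s.1 s.2 q p hp).2.2.2 hq

-- From `G [] ≤ G [d']` and the failure of `G [] ≤ d`, the rule rejects every first launch, so
-- nothing is ever run on the dataset. This is where the assumption on `G` enters.
open Classical in
theorem filtNIM_step_start (hG : ∀ d, G [] ≤ G [d]) (hd : ¬ G [] ≤ d) :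
    ∃ c : NIMQuery 𝒟 X → Bool × Answer 𝒟, ∀ x q,
      (filtNIM D adj (ruleOf G) d).step (some (x, [])) q =
        PMF.pure (if (c q).1 then none else some (x, []), (c q).2) := by
  refine ⟨fun
    | .launch M d' => if IsNoninteractiveDP D adj d' M then (true, .insufficientBudget)
      else (false, .notPrivate)
    | _ => (false, .invalidQuery), ?_⟩
  rintro x (⟨M, d'⟩ | _ | m)
  · by_cases hM : IsNoninteractiveDP D adj d' M
    · simp only [if_pos hM]
      refine (if_pos hM).trans (if_neg ?_)
      rw [ruleOf_eq_true]
      exact fun h => hd ((hG d').trans h)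
    · simp only [if_neg hM]
      exact if_neg hM
  · rfl
  · rfl

/-! ### The concurrent setting -/

/-- The privacy parameter declared in a query. -/
def IMQuery.param : IMQuery 𝒟 X → Option 𝒟
  | .launch _ d => some d
  | _ => none

theorem odomConIM_step_launch_pos {M : IM X} {d' : 𝒟} (h : IsDP D adj d' M)
    (x : X) (l : List (Launched 𝒟 X)) :
    (odomConIM D adj G).step (x, l) (.launch M d') = launchIM x l M d' := if_pos h

theorem odomConIM_step_launch_neg {M : IM X} {d' : 𝒟} (h : ¬ IsDP D adj d' M)
    (x : X) (l : List (Launched 𝒟 X)) :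
    (odomConIM D adj G).step (x, l) (.launch M d') = PMF.pure ((x, l), .notPrivate) := if_neg h

theorem odomConIM_step_support (x : X) (l : List (Launched 𝒟 X)) (q : IMQuery 𝒟 X) (p)
    (hp : p ∈ ((odomConIM D adj G).step (x, l) q).support) :
    ¬ p.2.IsStop ∧
      p.1.2.map Launched.param = updateParams q.param (l.map Launched.param) p.2 ∧
      (q = .privacyLoss → p.2 = .loss (G (l.map Launched.param))) ∧
      (q ≠ .privacyLoss → p.2.censor = p.2) := by
  cases q with
  | launch M d' =>
    by_cases hM : IsDP D adj d' M
    · rw [odomConIM_step_launch_pos D adj G hM] at hp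
      obtain ⟨hl, m, hm⟩ := launchIM_support hp
      rw [hl, hm]
      exact ⟨by simp [Answer.IsStop], rfl, nofun, fun _ => rfl⟩
    · rw [odomConIM_step_launch_neg D adj G hM] at hp
      obtain rfl := (PMF.mem_support_pure_iff _ _).1 hp
      exact ⟨by simp [Answer.IsStop], rfl, nofun, fun _ => rfl⟩
  | ask j q =>
    obtain ⟨hl, ⟨m, hm⟩ | hm⟩ := askIM_support hp
    all_goals
      rw [hl, hm]
      exact ⟨by simp [Answer.IsStop], rfl, nofun, fun _ => rfl⟩
  | privacyLoss =>
    obtain rfl := (PMF.mem_support_pure_iff _ _).1 hp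
    exact ⟨by simp [Answer.IsStop], rfl, fun _ => rfl, fun h => (h rfl).elim⟩
  | other m =>
    obtain rfl := (PMF.mem_support_pure_iff _ _).1 hp
    exact ⟨by simp [Answer.IsStop], rfl, nofun, fun _ => rfl⟩

/-- `FiltCon(IM)` runs `OdomCon(IM)`. -/
def runsUpToConIM : RunsUpTo G d (odomConIM D adj G) (filtConIM D adj (ruleOf G) d) where
  start x := (x, [])
  params s := s.2.map Launched.param
  run s := some s
  haltState := none
  param := IMQuery.param
  init_odometer _ := rfl
  init_filter _ := rfl
  params_start _ := rfl
  loss_eq _ := rfl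
  step_halt _ := rfl
  step_run := by
    rintro ⟨x, l⟩ (⟨M, d'⟩ | ⟨j, q⟩ | _ | m) hl
    · by_cases hM : IsDP D adj d' M
      · by_cases hd : G (l.map Launched.param ++ [d']) ≤ d
        · refine ((if_pos hM).trans (if_pos ((ruleOf_eq_true G).2 hd))).trans (Eq.symm ?_)
          refine (congrArg (PMF.map _) (odomConIM_step_launch_pos D adj G hM x l)).trans ?_
          refine map_congr_support _ fun p hp => ?_
          obtain ⟨h, m, hm⟩ := launchIM_support hp
          rw [h, if_pos hd, hm]
          rfl
        · refine ((if_pos hM).trans (if_neg (mt (ruleOf_eq_true G).1 hd))).trans (Eq.symm ?_)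
          refine (congrArg (PMF.map _) (odomConIM_step_launch_pos D adj G hM x l)).trans ?_
          -- Whatever first message the launched mechanism would send, it is replaced by the
          -- refusal.
          refine Eq.trans (map_congr_support _ fun p hp => ?_)
            (PMF.map_const (launchIM x l M d') _)
          rw [(launchIM_support hp).1, if_neg hd]
          rfl
      · refine (if_neg hM).trans (Eq.symm ?_)
        refine (congrArg (PMF.map _) (odomConIM_step_launch_neg D adj G hM x l)).trans ?_
        exact (PMF.pure_map _ _).trans (congrArg PMF.pure (if_pos hl))
    -- The parameters are unchanged, so the budget test succeeds by `hl`.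
    · refine map_congr_support (askIM x l j q) fun p hp => ?_
      obtain ⟨h, ⟨m, hm⟩ | hm⟩ := askIM_support hp
      all_goals
        rw [h, if_pos hl, hm]
        rfl
    · exact pure_map_eq _ _ _ (if_pos hl).symm
    · exact pure_map_eq _ _ _ (if_pos hl).symm
  not_isStop s q p hp := (odomConIM_step_support D adj G s.1 s.2 q p hp).1
  params_step s q p hp := (odomConIM_step_support D adj G s.1 s.2 q p hp).2.1
  step_loss s p hp := (odomConIM_step_support D adj G s.1 s.2 _ p hp).2.2.1 rfl
  censor_step s q hq p hp := (odomConIM_step_support D adj G s.1 s.2 q p hp).2.2.2 hq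

open Classical in
theorem filtConIM_step_start (hG : ∀ d, G [] ≤ G [d]) (hd : ¬ G [] ≤ d) :
    ∃ c : IMQuery 𝒟 X → Bool × Answer 𝒟, ∀ x q,
      (filtConIM D adj (ruleOf G) d).step (some (x, [])) q =
        PMF.pure (if (c q).1 then none else some (x, []), (c q).2) := by
  refine ⟨fun
    | .launch M d' => if IsDP D adj d' M then (true, .insufficientBudget) else (false, .notPrivate)
    | _ => (false, .invalidQuery), ?_⟩
  rintro x (⟨M, d'⟩ | ⟨j, q⟩ | _ | m)
  · by_cases hM : IsDP D adj d' M
    · simp only [if_pos hM]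
      refine (if_pos hM).trans (if_neg ?_)
      rw [ruleOf_eq_true]
      exact fun h => hd ((hG d').trans h)
    · simp only [if_neg hM]
      exact if_neg hM
  -- No mechanism has been launched, so every index is out of range and the query is invalid.
  · exact PMF.pure_map _ _
  · rfl
  · rfl

end Compositions

end

end ConcurrentDP

/-! ### Equivalence of accumulators and filters -/

theorem mainTheorem6 {𝒟 : Type} [PartialOrder 𝒟] (D : ConcurrentDP.GeneralizedDistance 𝒟)
    {X : Type} (adj : X → X → Prop) (G : List 𝒟 → 𝒟) :
    ((ConcurrentDP.IsValidNIMFilter D adj (ConcurrentDP.ruleOf G) →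
        ConcurrentDP.IsValidNIMAccumulator D adj G) ∧
      ((∀ d : 𝒟, G [] ≤ G [d]) →
        (ConcurrentDP.IsValidNIMAccumulator D adj G ↔
          ConcurrentDP.IsValidNIMFilter D adj (ConcurrentDP.ruleOf G)))) ∧
    ((ConcurrentDP.IsValidIMFilter D adj (ConcurrentDP.ruleOf G) →
        ConcurrentDP.IsValidIMAccumulator D adj G) ∧
      ((∀ d : 𝒟, G [] ≤ G [d]) →
        (ConcurrentDP.IsValidIMAccumulator D adj G ↔
          ConcurrentDP.IsValidIMFilter D adj (ConcurrentDP.ruleOf G)))) := by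
  have hNIM : ConcurrentDP.IsValidNIMFilter D adj (ConcurrentDP.ruleOf G) →
      ConcurrentDP.IsValidNIMAccumulator D adj G := fun h d 𝒜 x x' hx =>
    (ConcurrentDP.runsUpToNIM D adj G d).dist_truncatedView_le 𝒜 D fun ℬ => h d ℬ x x' hx
  have hIM : ConcurrentDP.IsValidIMFilter D adj (ConcurrentDP.ruleOf G) →
      ConcurrentDP.IsValidIMAccumulator D adj G := fun h d 𝒜 x x' hx =>
    (ConcurrentDP.runsUpToConIM D adj G d).dist_truncatedView_le 𝒜 D fun ℬ => h d ℬ x x' hx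
  refine ⟨⟨hNIM, fun hG => ⟨fun h d 𝒜 x x' hx => ?_, hNIM⟩⟩,
    ⟨hIM, fun hG => ⟨fun h d 𝒜 x x' hx => ?_, hIM⟩⟩⟩
  · exact (ConcurrentDP.runsUpToNIM D adj G d).dist_view_le 𝒜 D (fun ℬ => h d ℬ x x' hx)
      (ConcurrentDP.filtNIM_step_start D adj G d hG)
  · exact (ConcurrentDP.runsUpToConIM D adj G d).dist_view_le 𝒜 D (fun ℬ => h d ℬ x x' hx)
      (ConcurrentDP.filtConIM_step_start D adj G d hG)
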